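/- Write $\mathcal S(f)=\{x\in\mathbb R : f(x)\ge 0\}$ and let $\mathrm{QM}(f)=\{\sigma_0+\sigma_1 f : \sigma_0,\sigma_1 \text{ sums of squares in } \mathbb R[X]\}$ for $f\in\mathbb R[X]$. Suppose that $\mathcal S(f)=\bigcup_{i=0}^{k}[c_i,d_i]$ with $c_i\le d_i$ for $0\le i\le k$ and $d_i<c_{i+1}$ for $0\le i<k$. Let $0\le j<k$, let $m$ be odd and $n$ even, and suppose that $(X-d_j)^m(X-c_{j+1})^n$ divides $f$, where $m$ is the exact multiplicity of $d_j$ as a root of $f$ and the multiplicity of $c_{j+1}$ is $n$ or $n+1$ (that is, $(X-d_j)^{m+1}\nmid f$ and $(X-c_{j+1})^{n+2}\nmid f$). Then $$(X-d_j)^m(X-c_{j+1})^{n+1}\in \mathrm{QM}(f).$$ Furthermore, certificates are computable. Let a real algebraic number be encoded by a nonzero integer polynomial together with a closed interval with rational end points in which the number is the only real root of that polynomial; let a polynomial with real algebraic coefficients be encoded by the list of codes of its coefficients, and a sum of squares by the list of codes of the polynomials that are squared. There is a single algorithm (a partial recursive function) which, for all $f,j,m,n$ as above such that $f$ has real algebraic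 coefficients, given any codes of $f$, $d_j$ and $c_{j+1}$ together with $m$ and $n$, terminates and outputs codes of sums of squares $\sigma_0,\sigma_1$ of polynomials with real algebraic coefficients such that $$(X-d_j)^m(X-c_{j+1})^{n+1}=\sigma_0+\sigma_1 f.$$ -/

import Mathlib

open Polynomial

/-! ### Semialgebraic sets and quadratic modules on the line -/

/-- The basic closed semialgebraic set `{x | g x ≥ 0 for all g ∈ G}`. -/
def semialgebraicSet (G : Finset ℝ[X]) : Set ℝ :=
  {x | ∀ g ∈ G, 0 ≤ g.eval x}

/-- The quadratic module generated by `G`: all `σ₀ + ∑ σ_g g` with `σ₀` and all `σ_g`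
sums of squares of real polynomials. -/
def quadraticModule (G : Finset ℝ[X]) : Set ℝ[X] :=
  {p | ∃ (σ₀ : ℝ[X]) (σ : ℝ[X] → ℝ[X]),
    IsSumSq σ₀ ∧ (∀ g ∈ G, IsSumSq (σ g)) ∧ p = σ₀ + ∑ g ∈ G, σ g * g}

/-- `S` is the union of the pairwise disjoint compact intervals
`[c 0, d 0], …, [c k, d k]`, listed from left to right. One-point intervals are allowed. -/
structure IsIntervalUnion (S : Set ℝ) {k : ℕ} (c d : Fin (k + 1) → ℝ) : Prop where
  le : ∀ i, c i ≤ d i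
  lt : ∀ i : Fin k, d i.castSucc < c i.succ
  eq_iUnion : S = ⋃ i, Set.Icc (c i) (d i)

/-- The assumptions on a polynomial `f`, the right end point `d j` and the next left end
point `c (j + 1)` of its semialgebraic set, and the exponents `m` and `n`: the exponent `m` is
odd and is the exact multiplicity of `d j` as a root of `f`; the exponent `n` is even and the
multiplicity of `c (j + 1)` is `n` or `n + 1`. -/
structure IsGapDatum (f : ℝ[X]) {k : ℕ} (c d : Fin (k + 1) → ℝ) (j : Fin k) (m n : ℕ) :
    Prop where
  intervals : IsIntervalUnion (semialgebraicSet {f}) c d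
  odd : Odd m
  even : Even n
  dvd : (X - C (d j.castSucc)) ^ m * (X - C (c j.succ)) ^ n ∣ f
  left_exact : ¬ (X - C (d j.castSucc)) ^ (m + 1) ∣ f
  right_exact : ¬ (X - C (c j.succ)) ^ (n + 2) ∣ f

/-! ### Finite codes for real algebraic numbers and polynomials -/

/-- The polynomial with the given list of coefficients, constant coefficient first. -/
noncomputable def polyOfCoeffs {R : Type*} [CommRing R] (l : List R) : R[X] :=
  l.foldr (fun a p => C a + X * p) 0

/-- A code for a rational number: `(a, b)` stands for `a / (b + 1)`. -/
abbrev RatCode : Type := ℤ × ℕ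

/-- The rational number of a code, as a real number. -/
noncomputable def RatCode.val (r : RatCode) : ℝ := (r.1 : ℝ) / ((r.2 : ℝ) + 1)

/-- A code for a real algebraic number in isolating interval representation: the integer
coefficients of a polynomial, and the two rational end points of an interval. -/
abbrev AlgCode : Type := List ℤ × RatCode × RatCode

/-- The code `a` represents `x`: its polynomial is not zero, and `x` is the only real root of it
in its closed interval. -/
def AlgCode.Represents (a : AlgCode) (x : ℝ) : Prop :=
  polyOfCoeffs a.1 ≠ 0 ∧
    x ∈ Set.Icc (RatCode.val a.2.1) (RatCode.val a.2.2) ∧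
    Polynomial.aeval x (polyOfCoeffs a.1) = 0 ∧
    ∀ y ∈ Set.Icc (RatCode.val a.2.1) (RatCode.val a.2.2),
      Polynomial.aeval y (polyOfCoeffs a.1) = 0 → y = x

/-- A code for a polynomial with real algebraic coefficients: the list of codes of its
coefficients, constant coefficient first. -/
abbrev PolyCode : Type := List AlgCode

/-- The code `l` represents the real polynomial `p`. -/
def PolyCode.Represents (l : PolyCode) (p : ℝ[X]) : Prop :=
  ∃ as : List ℝ, List.Forall₂ AlgCode.Represents l as ∧ p = polyOfCoeffs as

/-- A code for a sum of squares of polynomials with real algebraic coefficients: the list of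
codes of the polynomials that are squared. -/
abbrev SosCode : Type := List PolyCode

/-- The code `l` represents the polynomial `σ` as an explicit sum of squares. -/
def SosCode.Represents (l : SosCode) (σ : ℝ[X]) : Prop :=
  ∃ ps : List ℝ[X], List.Forall₂ PolyCode.Represents l ps ∧ σ = (ps.map (fun p => p ^ 2)).sum

/-!
Let `d < c` be the two ends of the gap and `g = (X - d) ^ m (X - c) ^ (n + 1)`.

**Existence.** It suffices to find `σ ≥ 0` on `ℝ` with `σ f ≤ g` on `ℝ`, since nonnegative univariate
polynomials are sums of two squares (`AlgClosedInReal.exists_eq_sq_add_sq`). Dividing by the even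
powers `(x - d) ^ (m - 1) (x - c) ^ n` and writing `e` for minus the remaining cofactor of `f` after
also removing `x - d`, the inequality says that `σ e - (c - x)` has the sign of `x - d`. The
polynomial `e` is positive on `[d, c)`, and `(x - d) e > 0` outside a bounded set because `S(f)` is
compact. Hence a multiplier `σ` that makes `σ e` at least `1` on an interval and at most `1` next to
it solves the problem (`exists_multiplier_of_pos`, `exists_multiplier_of_simple_root`), and such a
multiplier is a fixed positive weight times a high even power of a quadratic polynomial
(`exists_nonneg_bump`). The construction takes place over any field `K` that is algebraically
closed in `ℝ`; the choice `K = ℝ` gives membership in the quadratic module, and the field of real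
algebraic numbers gives certificates with algebraic coefficients
(`AlgClosedInReal.exists_gap_certificate`).

**Computability.** The algorithm is an unbounded search for a certificate together with a proof of
its correctness that can be verified by a primitive recursive test (`Verifies`). All coefficients
are written as polynomials in one variable `T` over `ℚ`, and the certificate is required to hold in
`ℚ[T][X]` modulo a polynomial `P(T)`. If `P` changes sign on `[-1, 1]`, it has a root `θ` there, and
specialising `T` to `θ` gives a real certificate. The polynomial `A(T)` written for a coded number
is required to be a root modulo `P` of the polynomial of the code and to map `[-1, 1]` into the
interval of the code; as an input code isolates its number, `A(θ)` is then that number. The codes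
of the output must moreover have a positive derivative on their intervals, so that they isolate
(`Verifies.exists_certificate`). Conversely, a primitive element of the number field generated by
all coefficients, rescaled so that a small neighbourhood of it becomes `[-1, 1]`, turns every
algebraic certificate into a verifiable one (`exists_verifies`).
-/

/-! ### Nonnegative polynomials over fields that are algebraically closed in `ℝ` -/

/-- Every real number algebraic over `K` lies in `K`. -/
def AlgClosedInReal (K : Type*) [Field K] [Algebra K ℝ] : Prop :=
  ∀ x : ℝ, IsAlgebraic K x → x ∈ (algebraMap K ℝ).range

section NonnegPolynomial

variable {K : Type*} [Field K] [Algebra K ℝ]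

theorem AlgClosedInReal.exists_sq_eq (hK : AlgClosedInReal K) {a : K}
    (ha : 0 ≤ algebraMap K ℝ a) : ∃ b : K, b ^ 2 = a := by
  have h : IsAlgebraic K (√(algebraMap K ℝ a)) := by
    refine IsAlgebraic.of_pow (n := 2) (by norm_num) ?_
    rw [Real.sq_sqrt ha]
    exact isAlgebraic_algebraMap a
  obtain ⟨b, hb⟩ := hK _ h
  refine ⟨b, (algebraMap K ℝ).injective ?_⟩
  rw [map_pow, hb, Real.sq_sqrt ha]

/-- A polynomial that is nonnegative off one point is nonnegative. -/
theorem aeval_nonneg_of_ne {p : K[X]} (a : ℝ) (h : ∀ x : ℝ, x ≠ a → 0 ≤ aeval x p) (x : ℝ) :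
    0 ≤ aeval x p := by
  have hc : Continuous fun x : ℝ => aeval x p := by fun_prop
  have hcl : IsClosed {x : ℝ | 0 ≤ aeval x p} := isClosed_le continuous_const hc
  have hd : Dense ({a}ᶜ : Set ℝ) := dense_compl_singleton a
  exact (hcl.closure_subset_iff.2 (fun y hy => h y hy)) (hd x)

/-- A real root of a nonnegative polynomial is a double root. -/
theorem X_sub_C_sq_dvd_of_nonneg {p : K[X]} (hp : ∀ x : ℝ, 0 ≤ aeval x p) {a : K}
    (ha : p.eval a = 0) : (X - C a) ^ 2 ∣ p := by
  obtain ⟨q, rfl⟩ := dvd_iff_isRoot.2 ha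
  rw [sq]
  refine mul_dvd_mul_left _ (dvd_iff_isRoot.2 ?_)
  have hc : Continuous fun x : ℝ => aeval x q := by fun_prop
  have key : ∀ x : ℝ, 0 ≤ (x - algebraMap K ℝ a) * aeval x q := by
    intro x; simpa using hp x
  have h1 : 0 ≤ aeval (algebraMap K ℝ a) q := by
    refine le_of_tendsto_of_tendsto tendsto_const_nhds
      ((hc.tendsto _).mono_left (nhdsWithin_le_nhds (s := Set.Ioi (algebraMap K ℝ a)))) ?_
    filter_upwards [self_mem_nhdsWithin] with x hx
    exact nonneg_of_mul_nonneg_right (key x) (sub_pos.2 hx)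
  have h2 : aeval (algebraMap K ℝ a) q ≤ 0 := by
    refine le_of_tendsto_of_tendsto
      ((hc.tendsto _).mono_left (nhdsWithin_le_nhds (s := Set.Iio (algebraMap K ℝ a))))
      tendsto_const_nhds ?_
    filter_upwards [self_mem_nhdsWithin] with x hx
    have := key x
    have hx' : x - algebraMap K ℝ a < 0 := sub_neg.2 hx
    nlinarith
  have h3 : algebraMap K ℝ (q.eval a) = 0 := by
    rw [← aeval_algebraMap_apply_eq_algebraMap_eval]
    exact le_antisymm h2 h1
  exact (map_eq_zero _).1 h3

theorem isAlgebraic_re {z : ℂ} (hz : IsAlgebraic K z) : IsAlgebraic K z.re := by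
  have hc : IsAlgebraic K ((starRingEnd ℂ) z) := by
    obtain ⟨p, hp, h⟩ := hz
    refine ⟨p, hp, ?_⟩
    have := aeval_algHom_apply (Complex.conjAe.toAlgHom.restrictScalars K) z p
    rw [h, map_zero] at this
    exact this
  have h2 : IsAlgebraic K (algebraMap ℝ ℂ z.re) := by
    have : algebraMap ℝ ℂ z.re = (z + (starRingEnd ℂ) z) * algebraMap ℝ ℂ (algebraMap K ℝ 2⁻¹) := by
      rw [Complex.add_conj, map_inv₀, map_inv₀, map_ofNat, map_ofNat]
      push_cast
      rw [Complex.coe_algebraMap]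
      ring
    rw [this, ← IsScalarTower.algebraMap_apply K ℝ ℂ]
    exact (hz.add hc).mul (isAlgebraic_algebraMap _)
  exact (isAlgebraic_algebraMap_iff (algebraMap ℝ ℂ).injective).1 h2

theorem isAlgebraic_im {z : ℂ} (hz : IsAlgebraic K z) : IsAlgebraic K z.im := by
  have hI : IsAlgebraic K (-Complex.I) := by
    refine IsAlgebraic.of_pow (n := 2) (by norm_num) ?_
    rw [neg_sq, Complex.I_sq]
    exact isAlgebraic_one.neg
  have := isAlgebraic_re (hz.mul hI)
  simpa using this

/-- Over a field `K` that is algebraically closed in `ℝ`, a univariate polynomial that is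
nonnegative on `ℝ` is a sum of two squares: real roots are double, and a pair of conjugate
nonreal roots contributes a sum of two squares, which is multiplicative. -/
theorem AlgClosedInReal.exists_eq_sq_add_sq (hK : AlgClosedInReal K) (p : K[X])
    (hp : ∀ x : ℝ, 0 ≤ aeval x p) : ∃ a b : K[X], p = a ^ 2 + b ^ 2 := by
  induction hn : p.natDegree using Nat.strong_induction_on generalizing p with
  | _ n ih =>
  subst hn
  by_cases hd : p.natDegree = 0
  · rw [natDegree_eq_zero] at hd
    obtain ⟨a, rfl⟩ := hd
    obtain ⟨b, rfl⟩ := hK.exists_sq_eq (by simpa using hp 0)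
    exact ⟨C b, 0, by simp⟩
  have hp0 : p ≠ 0 := by rintro rfl; simp at hd
  obtain ⟨z, hz⟩ := IsAlgClosed.exists_aeval_eq_zero ℂ p
    (by rw [degree_eq_natDegree hp0]; exact_mod_cast hd)
  have hzalg : IsAlgebraic K z := ⟨p, hp0, hz⟩
  obtain ⟨u, hu⟩ := hK _ (isAlgebraic_re hzalg)
  obtain ⟨v, hv⟩ := hK _ (isAlgebraic_im hzalg)
  by_cases hv0 : v = 0
  · have hzu : z = algebraMap K ℂ u := by
      rw [IsScalarTower.algebraMap_apply K ℝ ℂ, hu]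
      apply Complex.ext
      · simp
      · rw [← hv, hv0]; simp
    have hroot : p.eval u = 0 := by
      rw [hzu, aeval_algebraMap_apply_eq_algebraMap_eval] at hz
      exact (map_eq_zero _).1 hz
    obtain ⟨q, rfl⟩ := X_sub_C_sq_dvd_of_nonneg hp hroot
    have hq0 : q ≠ 0 := right_ne_zero_of_mul hp0
    obtain ⟨a, b, hab⟩ := ih q.natDegree (by
      rw [natDegree_mul (pow_ne_zero _ (X_sub_C_ne_zero _)) hq0, natDegree_pow,
        natDegree_X_sub_C]; omega) q (aeval_nonneg_of_ne (algebraMap K ℝ u) (fun x hx => by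
          have h := hp x
          simp only [map_mul, map_pow, map_sub, aeval_X, aeval_C] at h
          exact nonneg_of_mul_nonneg_right h (by have := sub_ne_zero.2 hx; positivity))) rfl
    exact ⟨(X - C u) * a, (X - C u) * b, by rw [hab]; ring⟩
  · have hvR : algebraMap K ℝ v ≠ 0 := by simpa using hv0
    have hmonic : ((X - C u) ^ 2 + C (v ^ 2) : K[X]).Monic := by
      refine ((monic_X_sub_C u).pow 2).add_of_left ?_
      rw [degree_pow, degree_X_sub_C]
      exact lt_of_le_of_lt degree_C_le (by norm_num)
    have hdeg : ((X - C u) ^ 2 + C (v ^ 2) : K[X]).natDegree = 2 := by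
      rw [natDegree_add_C, natDegree_pow, natDegree_X_sub_C]
    have hdvd : ((X - C u) ^ 2 + C (v ^ 2)) ∣ p := by
      rw [← modByMonic_eq_zero_iff_dvd hmonic]
      set r := p %ₘ ((X - C u) ^ 2 + C (v ^ 2)) with hr
      have hrdeg : r.degree < 2 := by
        have := degree_modByMonic_lt p hmonic
        rwa [degree_eq_natDegree hmonic.ne_zero, hdeg] at this
      have hrz : aeval z r = 0 := by
        have h1 : aeval z ((X - C u) ^ 2 + C (v ^ 2) : K[X]) = 0 := by
          simp only [map_add, map_pow, map_sub, aeval_X, aeval_C]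
          rw [IsScalarTower.algebraMap_apply K ℝ ℂ, IsScalarTower.algebraMap_apply K ℝ ℂ v, hu, hv]
          apply Complex.ext <;> simp [sq]
        have h2 := congrArg (aeval z) (modByMonic_add_div p ((X - C u) ^ 2 + C (v ^ 2)))
        rw [map_add, map_mul, h1, zero_mul, add_zero, hz] at h2
        exact h2
      obtain ⟨s, t, hst⟩ : ∃ s t : K, r = C s * X + C t := by
        refine ⟨r.coeff 1, r.coeff 0, ?_⟩
        exact eq_X_add_C_of_degree_le_one (Order.le_of_lt_succ hrdeg)
      rw [hst] at hrz ⊢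
      simp only [map_add, map_mul, aeval_X, aeval_C] at hrz
      rw [IsScalarTower.algebraMap_apply K ℝ ℂ, IsScalarTower.algebraMap_apply K ℝ ℂ t] at hrz
      have him := congrArg Complex.im hrz
      have hre := congrArg Complex.re hrz
      simp at him hre
      rw [← hv] at him
      have hs : s = 0 := by
        rcases him with h | h
        · exact h
        · exact absurd (by simpa using h) hv0
      simp [hs] at hre
      simp [hs, hre]
    obtain ⟨q, rfl⟩ := hdvd
    have hq0 : q ≠ 0 := right_ne_zero_of_mul hp0
    obtain ⟨a, b, hab⟩ := ih q.natDegree (by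
      rw [natDegree_mul hmonic.ne_zero hq0, hdeg]; omega) q (fun x => by
          have h := hp x
          simp only [map_mul, map_add, map_pow, map_sub, aeval_X, aeval_C] at h
          exact nonneg_of_mul_nonneg_right h (by positivity)) rfl
    refine ⟨(X - C u) * a - C v * b, (X - C u) * b + C v * a, ?_⟩
    rw [hab, C_pow]; ring

end NonnegPolynomial

/-! ### Certificates across a gap -/

section GapCertificate

variable {K : Type*} [Field K] [Algebra K ℝ]

/-- A positive weight `ρ` normalising `e` by `ρ e = 1` at `a` and at `b`. -/
theorem exists_normalizing_weight (e : K[X]) {a b : K} (hne : a ≠ b)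
    (hea : 0 < algebraMap K ℝ (e.eval a)) (heb : 0 < algebraMap K ℝ (e.eval b)) :
    ∃ ρ E₁ : K[X], (∀ x : ℝ, 0 < aeval x ρ) ∧ ∀ x : ℝ, aeval x ρ * aeval x e =
      1 - (x - algebraMap K ℝ a) * (algebraMap K ℝ b - x) * aeval x E₁ := by
  set φ := algebraMap K ℝ
  have hea0 : e.eval a ≠ 0 := fun h => by simp [h] at hea
  have heb0 : e.eval b ≠ 0 := fun h => by simp [h] at heb
  have hba0 : b - a ≠ 0 := sub_ne_zero.2 hne.symm
  have hab0 : a - b ≠ 0 := sub_ne_zero.2 hne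
  have h1 : 0 < φ ((e.eval a)⁻¹ * ((a - b) ^ 2)⁻¹) := by
    have : φ (a - b) ≠ 0 := (_root_.map_ne_zero _).2 hab0
    rw [map_mul, map_inv₀, map_inv₀, map_pow]; positivity
  have h2 : 0 < φ ((e.eval b)⁻¹ * ((b - a) ^ 2)⁻¹) := by
    have : φ (b - a) ≠ 0 := (_root_.map_ne_zero _).2 hba0
    rw [map_mul, map_inv₀, map_inv₀, map_pow]; positivity
  set ρ : K[X] := C ((e.eval a)⁻¹ * ((a - b) ^ 2)⁻¹) * (X - C b) ^ 2 +
    C ((e.eval b)⁻¹ * ((b - a) ^ 2)⁻¹) * (X - C a) ^ 2 with hρ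
  have hρpos : ∀ x : ℝ, 0 < aeval x ρ := by
    intro x
    simp only [hρ, map_add, map_mul _ (C _), map_pow, map_sub, aeval_X, aeval_C]
    by_cases hx : x = φ a
    · have : 0 < (x - φ b) ^ 2 := by
        have : x - φ b ≠ 0 := sub_ne_zero.2 (hx ▸ fun h => hne (φ.injective h))
        positivity
      exact add_pos_of_pos_of_nonneg (mul_pos h1 this) (mul_nonneg h2.le (sq_nonneg _))
    · have : 0 < (x - φ a) ^ 2 := by
        have := sub_ne_zero.2 hx; positivity
      exact add_pos_of_nonneg_of_pos (mul_nonneg h1.le (sq_nonneg _)) (mul_pos h2 this)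
  obtain ⟨E₁, hE₁⟩ : (X - C a) * (X - C b) ∣ ρ * e - 1 := by
    refine (isCoprime_X_sub_C_of_isUnit_sub (isUnit_iff_ne_zero.2 hab0)).mul_dvd
      (dvd_iff_isRoot.2 ?_) (dvd_iff_isRoot.2 ?_)
    · simp only [hρ, IsRoot.def, eval_sub, eval_mul, eval_add, eval_pow, eval_C, eval_X, eval_one]
      field_simp; ring
    · simp only [hρ, IsRoot.def, eval_sub, eval_mul, eval_add, eval_pow, eval_C, eval_X, eval_one]
      field_simp; ring
  refine ⟨ρ, E₁, hρpos, fun x => ?_⟩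
  have := congrArg (aeval x) hE₁
  simp only [map_sub, map_mul, map_one, aeval_X, aeval_C] at this
  linear_combination this

theorem one_add_le_one_add_pow {y Q : ℝ} (N : ℕ) (hQ : 0 < Q) (hy : 0 ≤ y) :
    1 + 2 * (N / Q) * y ≤ (1 + y / Q) ^ (2 * N) := by
  have hyQ : 0 ≤ y / Q := by positivity
  refine le_trans (le_of_eq ?_) (one_add_mul_le_pow (by linarith) (2 * N))
  push_cast; ring

theorem one_sub_pow_mul_le_one {w Q : ℝ} (N : ℕ) (hQ : 0 < Q) (hw : 0 ≤ w) (hwQ : w / Q ≤ 1) :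
    (1 - w / Q) ^ (2 * N) * (1 + 2 * (N / Q) * w) ≤ 1 := by
  have hwQ0 : 0 ≤ w / Q := by positivity
  calc (1 - w / Q) ^ (2 * N) * (1 + 2 * (N / Q) * w)
      ≤ (1 - w / Q) ^ (2 * N) * (1 + w / Q) ^ (2 * N) :=
        mul_le_mul_of_nonneg_left (one_add_le_one_add_pow N hQ hw) (pow_nonneg (by linarith) _)
    _ = (1 - (w / Q) ^ 2) ^ (2 * N) := by rw [← mul_pow]; ring
    _ ≤ 1 := pow_le_one₀ (by nlinarith) (by nlinarith)

/-- If `e` is positive on `[a, b]`, some nonnegative `σ` makes `σ e` at least `1` on `[a, b]`, at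
most `1` on the rest of a given bounded interval, and there uniformly small away from `a`, `b`.

With `y = (x - a) (b - x)`, the multiplier is `ρ (1 + y / Q) ^ (2 N)` where `ρ > 0` is normalised
by `ρ e = 1` at `a` and `b`, so that `ρ e = 1 - y E₁`; Bernoulli's inequality
`(1 + |y| / Q) ^ (2 N) ≥ 1 + 2 N |y| / Q` beats the error term `y E₁` once `N` is large. -/
theorem exists_nonneg_bump (e : K[X]) {a b : K} (hab : algebraMap K ℝ a < algebraMap K ℝ b)
    (hpos : ∀ x ∈ Set.Icc (algebraMap K ℝ a) (algebraMap K ℝ b), 0 < aeval x e)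
    (R : ℝ) {y₀ ε : ℝ} (hy₀ : 0 < y₀) (hε : 0 < ε) :
    ∃ σ : K[X], (∀ x : ℝ, 0 ≤ aeval x σ) ∧
      (∀ x ∈ Set.Icc (algebraMap K ℝ a) (algebraMap K ℝ b), 1 ≤ aeval x σ * aeval x e) ∧
      (∀ x ∈ Set.Icc (-R) R, x ∉ Set.Icc (algebraMap K ℝ a) (algebraMap K ℝ b) →
        aeval x σ * aeval x e ≤ 1) ∧
      (∀ x ∈ Set.Icc (-R) R, (x - algebraMap K ℝ a) * (algebraMap K ℝ b - x) ≤ -y₀ →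
        |aeval x σ * aeval x e| ≤ ε) := by
  set φ := algebraMap K ℝ
  have hev : ∀ t : K, aeval (φ t) e = φ (e.eval t) := fun t =>
    aeval_algebraMap_apply_eq_algebraMap_eval t e
  obtain ⟨ρ, E₁, hρpos, hE⟩ := exists_normalizing_weight e (a := a) (b := b)
    (by rintro rfl; exact lt_irrefl _ hab) (hev a ▸ hpos _ ⟨le_rfl, hab.le⟩)
    (hev b ▸ hpos _ ⟨hab.le, le_rfl⟩)
  set I : Set ℝ := Set.Icc (-R) R ∪ Set.Icc (φ a) (φ b)
  have hI : IsCompact I := isCompact_Icc.union isCompact_Icc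
  obtain ⟨M, hM⟩ := hI.exists_bound_of_continuousOn
    (f := fun x : ℝ => aeval x E₁) (by fun_prop)
  obtain ⟨Y, hY⟩ := hI.exists_bound_of_continuousOn
    (f := fun x : ℝ => (x - φ a) * (φ b - x)) (by fun_prop)
  have hM0 : 0 ≤ M := (norm_nonneg _).trans (hM (φ a) (Or.inr ⟨le_rfl, hab.le⟩))
  obtain ⟨x₀, hx₀, hmin⟩ := (isCompact_Icc (a := φ a) (b := φ b)).exists_isMinOn
    ⟨_, le_rfl, hab.le⟩ (f := fun x : ℝ => aeval x ρ * aeval x e) (by fun_prop)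
  set μ := aeval x₀ ρ * aeval x₀ e
  have hμ : 0 < μ := mul_pos (hρpos _) (hpos _ hx₀)
  obtain ⟨Q, hQ⟩ := exists_nat_ge (max Y 1)
  have hQ1 : (1 : ℝ) ≤ Q := (le_max_right _ _).trans hQ
  have hQY : Y ≤ Q := (le_max_left _ _).trans hQ
  have hQ0 : (0 : ℝ) < Q := by linarith
  obtain ⟨N, hN⟩ := exists_nat_ge (Q * (M + M / μ + (ε * y₀)⁻¹ + M / ε))
  set T : ℝ := N / Q with hTdef
  have hT : M + M / μ + (ε * y₀)⁻¹ + M / ε ≤ T := by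
    rw [hTdef, le_div_iff₀ hQ0]; linarith
  have hp1 : 0 ≤ M / μ := by positivity
  have hp2 : 0 ≤ (ε * y₀)⁻¹ := by positivity
  have hp3 : 0 ≤ M / ε := by positivity
  have hT0 : 0 ≤ T := by positivity
  have hT1 : M ≤ T := by linarith
  have hT2 : M ≤ T * μ := by rw [← div_le_iff₀ hμ]; linarith
  have hT3 : 1 ≤ T * (ε * y₀) := by
    rw [← div_le_iff₀ (by positivity), one_div]; linarith
  have hT4 : M ≤ T * ε := by rw [← div_le_iff₀ hε]; linarith
  set B : K[X] := 1 + C ((Q : K)⁻¹) * ((X - C a) * (C b - X)) with hB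
  have hBx : ∀ x : ℝ, aeval x B = 1 + (x - φ a) * (φ b - x) / Q := by
    intro x
    simp only [hB, map_add, map_mul, map_one, map_sub, aeval_X, aeval_C, map_inv₀, map_natCast]
    ring
  have hcalc : ∀ x : ℝ, aeval x (ρ * B ^ (2 * N)) * aeval x e =
      (aeval x ρ * aeval x e) * (1 + (x - φ a) * (φ b - x) / Q) ^ (2 * N) := by
    intro x; rw [map_mul, map_pow, hBx]; ring
  have houter : ∀ x ∈ I, (x - φ a) * (φ b - x) ≤ 0 → ∃ w s : ℝ, (x - φ a) * (φ b - x) = -w ∧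
      0 ≤ w ∧ 0 ≤ s ∧ s * (1 + 2 * T * w) ≤ 1 ∧
      aeval x (ρ * B ^ (2 * N)) * aeval x e = (1 + w * aeval x E₁) * s ∧
      |1 + w * aeval x E₁| ≤ 1 + w * M := by
    intro x hx hy
    obtain ⟨w, hw⟩ : ∃ w, (x - φ a) * (φ b - x) = -w := ⟨_, (neg_neg _).symm⟩
    have hw0 : 0 ≤ w := by linarith
    have hwQ : w / Q ≤ 1 := by
      rw [div_le_one hQ0]
      have := hY x hx
      simp only [hw, norm_neg, Real.norm_eq_abs, abs_of_nonneg hw0] at this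
      linarith
    refine ⟨w, (1 - w / Q) ^ (2 * N), hw, hw0, pow_nonneg (by linarith) _,
      one_sub_pow_mul_le_one N hQ0 hw0 hwQ, ?_, ?_⟩
    · rw [hcalc, hE, hw]; ring
    · have h1 := hM x hx
      rw [Real.norm_eq_abs] at h1
      calc |1 + w * aeval x E₁| ≤ |1| + |w * aeval x E₁| := abs_add_le _ _
        _ = 1 + w * |aeval x E₁| := by rw [abs_one, abs_mul, abs_of_nonneg hw0]
        _ ≤ 1 + w * M := by gcongr
  refine ⟨ρ * B ^ (2 * N), ?_, ?_, ?_, ?_⟩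
  · intro x
    rw [map_mul, pow_mul, map_pow, map_pow]
    have := (hρpos x).le
    positivity
  · intro x hx
    rw [hcalc]
    set y := (x - φ a) * (φ b - x) with hy
    have hy0 : 0 ≤ y := mul_nonneg (by linarith [hx.1]) (by linarith [hx.2])
    have h1 : 1 + 2 * T * y ≤ (1 + y / Q) ^ (2 * N) := one_add_le_one_add_pow N hQ0 hy0
    have hEμ : μ ≤ aeval x ρ * aeval x e := hmin hx
    have hE1 : 1 - y * M ≤ aeval x ρ * aeval x e := by
      rw [hE]
      have := (abs_le.1 (hM x (Or.inr hx))).2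
      have := mul_le_mul_of_nonneg_left this hy0
      linarith
    have h2 : 0 ≤ T * y := by positivity
    have h3 := mul_le_mul_of_nonneg_left hEμ h2
    have h4 := mul_le_mul_of_nonneg_left hT2 hy0
    calc (1 : ℝ) ≤ (aeval x ρ * aeval x e) * (1 + 2 * T * y) := by nlinarith
      _ ≤ _ := mul_le_mul_of_nonneg_left h1 (hμ.le.trans hEμ)
  · intro x hx hx'
    have hy : (x - φ a) * (φ b - x) ≤ 0 := by
      by_contra! h
      rcases lt_or_ge x (φ a) with h1 | h1
      · nlinarith
      · exact hx' ⟨h1, by by_contra! h2; nlinarith⟩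
    obtain ⟨w, s, -, hw0, hs, hsT, heq, habs⟩ := houter x (Or.inl hx) hy
    rw [heq]
    have h1 : (1 + w * aeval x E₁) * s ≤ (1 + w * M) * s :=
      mul_le_mul_of_nonneg_right ((le_abs_self _).trans habs) hs
    have h4 := mul_le_mul_of_nonneg_left hT1 hw0
    have h5 := mul_nonneg hT0 hw0
    have h2 : (1 + w * M) * s ≤ (1 + 2 * T * w) * s :=
      mul_le_mul_of_nonneg_right (by linarith) hs
    linarith
  · intro x hx hxy
    obtain ⟨w, s, hw, hw0, hs, hsT, heq, habs⟩ := houter x (Or.inl hx) (by linarith)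
    rw [heq, abs_mul, abs_of_nonneg hs]
    have h3 : 1 ≤ ε * (T * w) := by
      have : T * (ε * y₀) ≤ T * (ε * w) := by
        have : y₀ ≤ w := by linarith
        gcongr
      linarith
    have h1 : |1 + w * aeval x E₁| * s ≤ (1 + w * M) * s := mul_le_mul_of_nonneg_right habs hs
    have h4 := mul_le_mul_of_nonneg_left hT4 hw0
    have h2 : (1 + w * M) * s ≤ (ε * (1 + 2 * T * w)) * s :=
      mul_le_mul_of_nonneg_right (by linarith) hs
    have h5 := mul_le_mul_of_nonneg_left hsT hε.le
    linarith

/-- The case of an even multiplicity at the right end of the gap: `e` is positive at `c`. The bump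
lives on an interval `[d, c']` slightly longer than the gap, on which `e` is still positive. -/
theorem exists_multiplier_of_pos {e : K[X]} {d c : K} (hdc : algebraMap K ℝ d < algebraMap K ℝ c)
    (hpos : ∀ x ∈ Set.Icc (algebraMap K ℝ d) (algebraMap K ℝ c), 0 < aeval x e) {R : ℝ}
    (hR : ∀ x : ℝ, R < |x| → 0 < (x - algebraMap K ℝ d) * aeval x e) :
    ∃ σ : K[X], (∀ x : ℝ, 0 ≤ aeval x σ) ∧ ∀ x : ℝ, 0 ≤ (x - algebraMap K ℝ d) *
      (aeval x σ * aeval x e - (algebraMap K ℝ c - x)) := by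
  set φ := algebraMap K ℝ
  have hc0 : 0 < aeval (φ c) e := hpos _ ⟨hdc.le, le_rfl⟩
  have hcont : Continuous fun x : ℝ => aeval x e := by fun_prop
  obtain ⟨δ, hδ, hball⟩ := Metric.eventually_nhds_iff.1
    (hcont.continuousAt.eventually_const_lt hc0)
  obtain ⟨q, hq1, hq2⟩ := exists_rat_btwn (show φ c < φ c + δ / 2 by linarith)
  have hφq : φ (q : K) = q := map_ratCast φ q
  have hpos' : ∀ x, φ d ≤ x → x < φ c + δ → 0 < aeval x e := by
    intro x h1 h2
    rcases le_or_gt x (φ c) with h | h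
    · exact hpos x ⟨h1, h⟩
    · exact hball (by rw [Real.dist_eq, abs_of_pos] <;> linarith)
  have hcd : 0 < φ c - φ d := by linarith
  obtain ⟨σ, hσ0, hin, hout, hsmall⟩ := exists_nonneg_bump e (a := d) (b := (q : K))
    (by rw [hφq]; linarith) (by rw [hφq]; intro x hx; exact hpos' x hx.1 (by linarith [hx.2])) R
    (y₀ := (φ c + δ - φ d) * (φ c + δ - q)) (ε := (q - φ c) / (φ c - φ d))
    (mul_pos (by linarith) (by linarith)) (div_pos (by linarith) hcd)
  rw [hφq] at hin hout hsmall
  refine ⟨C (c - d) * σ, fun x => ?_, fun x => ?_⟩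
  · rw [map_mul, aeval_C, map_sub]
    exact mul_nonneg hcd.le (hσ0 x)
  · rw [map_mul, aeval_C, map_sub]
    change 0 ≤ (x - φ d) * ((φ c - φ d) * aeval x σ * aeval x e - (φ c - x))
    rcases lt_or_ge x (φ d) with hx | hx
    · refine mul_nonneg_of_nonpos_of_nonpos (by linarith) ?_
      have : aeval x σ * aeval x e ≤ 1 := by
        by_cases hxR : |x| ≤ R
        · exact hout x (abs_le.1 hxR) (fun h => by linarith [h.1])
        · have h1 := hR x (not_le.1 hxR)
          have h2 : aeval x e < 0 := by by_contra! h; nlinarith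
          nlinarith [hσ0 x]
      nlinarith
    · refine mul_nonneg (by linarith) ?_
      rcases le_or_gt x q with hxq | hxq
      · have := hin x ⟨hx, hxq⟩
        nlinarith
      · rcases le_or_gt 0 (aeval x e) with he | he
        · have := mul_nonneg (mul_nonneg hcd.le (hσ0 x)) he
          linarith
        · have hxR : |x| ≤ R := by
            by_contra! h
            have := hR x h
            nlinarith
          have hx'' : φ c + δ ≤ x := by
            by_contra! h
            exact absurd (hpos' x hx h) (not_lt.2 he.le)
          have h1 := hsmall x (abs_le.1 hxR) (by nlinarith)
          have h2 := (abs_le.1 h1).1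
          have h3 : -(q - φ c) ≤ (φ c - φ d) * (aeval x σ * aeval x e) := by
            have := mul_le_mul_of_nonneg_left h2 hcd.le
            rw [mul_neg, mul_div_cancel₀ _ hcd.ne'] at this
            exact this
          nlinarith

/-- The case of an odd multiplicity at the right end of the gap: `e` has a simple root at `c`. -/
theorem exists_multiplier_of_simple_root {e : K[X]} {d c : K}
    (hdc : algebraMap K ℝ d < algebraMap K ℝ c)
    (hpos : ∀ x ∈ Set.Ico (algebraMap K ℝ d) (algebraMap K ℝ c), 0 < aeval x e)
    (hroot : e.eval c = 0) (hsimple : ¬ (X - C c) ^ 2 ∣ e) {R : ℝ}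
    (hR : ∀ x : ℝ, R < |x| → 0 < (x - algebraMap K ℝ d) * aeval x e) :
    ∃ σ : K[X], (∀ x : ℝ, 0 ≤ aeval x σ) ∧ ∀ x : ℝ, 0 ≤ (x - algebraMap K ℝ d) *
      (aeval x σ * aeval x e - (algebraMap K ℝ c - x)) := by
  set φ := algebraMap K ℝ
  obtain ⟨p, hp⟩ := dvd_iff_isRoot.2 hroot
  obtain ⟨e₂, rfl⟩ : ∃ e₂, p = -e₂ := ⟨_, (neg_neg _).symm⟩
  have hex : ∀ x : ℝ, aeval x e = (φ c - x) * aeval x e₂ := by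
    intro x
    rw [hp]
    simp only [map_mul, map_neg, map_sub, aeval_X, aeval_C]
    ring
  have hcont : Continuous fun x : ℝ => aeval x e₂ := by fun_prop
  have hlt : ∀ x ∈ Set.Ico (φ d) (φ c), 0 < aeval x e₂ := by
    intro x hx
    have := hpos x hx
    rw [hex] at this
    exact pos_of_mul_pos_right this (by linarith [hx.2])
  have hc : 0 < aeval (φ c) e₂ := by
    refine lt_of_le_of_ne ?_ (fun h => hsimple ?_)
    · refine le_of_tendsto_of_tendsto tendsto_const_nhds
        ((hcont.tendsto _).mono_left (nhdsWithin_le_nhds (s := Set.Iio (φ c)))) ?_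
      filter_upwards [Ioo_mem_nhdsLT hdc] with x hx
      exact (hlt x ⟨hx.1.le, hx.2⟩).le
    · rw [hp, sq]
      refine mul_dvd_mul_left _ ((dvd_neg).2 (dvd_iff_isRoot.2 ?_))
      rw [aeval_algebraMap_apply_eq_algebraMap_eval] at h
      exact (map_eq_zero _).1 h.symm
  obtain ⟨σ, hσ0, hin, hout, -⟩ := exists_nonneg_bump e₂ hdc (fun x hx => by
    rcases hx.2.lt_or_eq with h | h
    · exact hlt x ⟨hx.1, h⟩
    · rw [h]; exact hc) (max R (max |φ c| |φ d|)) one_pos one_pos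
  refine ⟨σ, hσ0, fun x => ?_⟩
  rw [hex]
  have heq : (x - φ d) * (aeval x σ * ((φ c - x) * aeval x e₂) - (φ c - x)) =
    ((x - φ d) * (φ c - x)) * (aeval x σ * aeval x e₂ - 1) := by ring
  rw [heq]
  by_cases hx : x ∈ Set.Icc (φ d) (φ c)
  · exact mul_nonneg (mul_nonneg (by linarith [hx.1]) (by linarith [hx.2]))
      (by linarith [hin x hx])
  · have hy : (x - φ d) * (φ c - x) ≤ 0 := by
      by_contra! h
      rcases lt_or_ge x (φ d) with h1 | h1
      · nlinarith
      · exact hx ⟨h1, by by_contra! h2; nlinarith⟩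
    refine mul_nonneg_of_nonpos_of_nonpos hy ?_
    by_cases hxR : |x| ≤ max R (max |φ c| |φ d|)
    · linarith [hout x (abs_le.1 hxR) hx]
    · have h1 := hR x (lt_of_le_of_lt (le_max_left _ _) (not_le.1 hxR))
      rw [hex, ← mul_assoc] at h1
      have h2 : aeval x e₂ < 0 := by by_contra! h; nlinarith
      nlinarith [hσ0 x]

/-- If `f` is negative on `(d, c)` and outside a bounded set, vanishes at `d` to the exact odd order
`m` and at `c` to the order `n` or `n + 1` with `n` even, then
`(X - d) ^ m (X - c) ^ (n + 1)` has a certificate with coefficients in `K`. Dividing by the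
square `(x - d) ^ (m - 1) (x - c) ^ n` reduces the nonnegativity of the remainder to the case
`m = 1`, `n = 0`. -/
theorem AlgClosedInReal.exists_gap_certificate (hK : AlgClosedInReal K) {f : K[X]} {d c : K}
    {m n : ℕ} (hdc : algebraMap K ℝ d < algebraMap K ℝ c) (hm : Odd m) (hn : Even n)
    (hdvd : (X - C d) ^ m * (X - C c) ^ n ∣ f) (hleft : ¬ (X - C d) ^ (m + 1) ∣ f)
    (hright : ¬ (X - C c) ^ (n + 2) ∣ f)
    (hgap : ∀ x ∈ Set.Ioo (algebraMap K ℝ d) (algebraMap K ℝ c), aeval x f < 0)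
    {R : ℝ} (hR : ∀ x : ℝ, R < |x| → aeval x f < 0) :
    ∃ p q r s : K[X], (X - C d) ^ m * (X - C c) ^ (n + 1) =
      (p ^ 2 + q ^ 2) + (r ^ 2 + s ^ 2) * f := by
  set φ := algebraMap K ℝ
  obtain ⟨g, hg⟩ := hdvd
  obtain ⟨e, rfl⟩ : ∃ e, g = -e := ⟨_, (neg_neg _).symm⟩
  obtain ⟨l, rfl⟩ := hm
  obtain ⟨k, rfl⟩ := hn
  have hfx : ∀ x : ℝ, aeval x f = -(((x - φ d) ^ l * (x - φ c) ^ k) ^ 2 *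
      ((x - φ d) * aeval x e)) := by
    intro x
    rw [hg]
    simp only [map_mul, map_pow, map_neg, map_sub, aeval_X, aeval_C]
    ring
  have hsign : ∀ x : ℝ, aeval x f < 0 → 0 < (x - φ d) * aeval x e := by
    intro x hx
    rw [hfx] at hx
    exact pos_of_mul_pos_right (neg_neg_iff_pos.1 hx) (sq_nonneg _)
  have hR' : ∀ x : ℝ, R < |x| → 0 < (x - φ d) * aeval x e := fun x hx => hsign x (hR x hx)
  have hcont : Continuous fun x : ℝ => aeval x e := by fun_prop
  have hgap' : ∀ x ∈ Set.Ioo (φ d) (φ c), 0 < aeval x e := fun x hx =>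
    pos_of_mul_pos_right (hsign x (hgap x hx)) (by linarith [hx.1])
  have hd0 : e.eval d ≠ 0 := by
    intro h
    refine hleft ?_
    obtain ⟨u, rfl⟩ := dvd_iff_isRoot.2 h
    exact ⟨(X - C c) ^ (k + k) * -u, by rw [hg]; ring⟩
  have hclos : ∀ x ∈ Set.Icc (φ d) (φ c), 0 ≤ aeval x e := by
    have hcl : IsClosed {x : ℝ | 0 ≤ aeval x e} := isClosed_le continuous_const hcont
    rw [← closure_Ioo hdc.ne]
    exact hcl.closure_subset_iff.2 fun x hx => (hgap' x hx).le
  have hdpos : 0 < aeval (φ d) e := by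
    refine lt_of_le_of_ne (hclos _ ⟨le_rfl, hdc.le⟩) (fun h => hd0 ?_)
    rw [aeval_algebraMap_apply_eq_algebraMap_eval] at h
    exact (map_eq_zero _).1 h.symm
  have hIco : ∀ x ∈ Set.Ico (φ d) (φ c), 0 < aeval x e := by
    intro x hx
    rcases hx.1.lt_or_eq with h | h
    · exact hgap' x ⟨h, hx.2⟩
    · rw [← h]; exact hdpos
  obtain ⟨σ, hσ0, hσ⟩ : ∃ σ : K[X], (∀ x : ℝ, 0 ≤ aeval x σ) ∧ ∀ x : ℝ, 0 ≤ (x - φ d) *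
      (aeval x σ * aeval x e - (φ c - x)) := by
    by_cases hc : e.eval c = 0
    · refine exists_multiplier_of_simple_root hdc hIco hc (fun h => hright ?_) hR'
      obtain ⟨u, rfl⟩ := h
      exact ⟨(X - C d) ^ (2 * l + 1) * -u, by rw [hg]; ring⟩
    · refine exists_multiplier_of_pos hdc (fun x hx => ?_) hR'
      rcases hx.2.lt_or_eq with h | h
      · exact hIco x ⟨hx.1, h⟩
      · refine lt_of_le_of_ne (hclos x hx) (fun h0 => hc ?_)
        rw [h, aeval_algebraMap_apply_eq_algebraMap_eval] at h0
        exact (map_eq_zero _).1 h0.symm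
  obtain ⟨r, s, hrs⟩ := hK.exists_eq_sq_add_sq σ hσ0
  obtain ⟨p, q, hpq⟩ := hK.exists_eq_sq_add_sq
    ((X - C d) ^ (2 * l + 1) * (X - C c) ^ (k + k + 1) - σ * f) (fun x => by
      rw [map_sub, map_mul (aeval x) σ, hfx]
      simp only [map_mul, map_pow, map_sub, aeval_X, aeval_C]
      have := mul_nonneg (sq_nonneg ((x - φ d) ^ l * (x - φ c) ^ k)) (hσ x)
      refine this.trans (le_of_eq ?_)
      ring)
  exact ⟨p, q, r, s, by rw [← hpq, ← hrs]; ring⟩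

end GapCertificate

/-! ### Primitive recursive arithmetic on integers and rational codes -/

section IntegerArithmetic

theorem intEquivNat_natCast (n : ℕ) : Equiv.intEquivNat (n : ℤ) = 2 * n := by
  change Equiv.natSumNatEquivNat (Sum.inl n) = _
  simp

theorem intEquivNat_negSucc (n : ℕ) : Equiv.intEquivNat (Int.negSucc n) = 2 * n + 1 := by
  change Equiv.natSumNatEquivNat (Sum.inr n) = _
  simp

theorem primrec_subNatNat : Primrec₂ fun m n : ℕ => (m : ℤ) - n := by
  have h : Primrec fun p : ℕ × ℕ =>
      Denumerable.ofNat ℤ (if p.2 ≤ p.1 then 2 * (p.1 - p.2) else 2 * (p.2 - p.1 - 1) + 1) := by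
    refine (Primrec.ofNat ℤ).comp (Primrec.ite ?_ ?_ ?_)
    · exact Primrec.nat_le.comp Primrec.snd Primrec.fst
    · exact Primrec.nat_double.comp (Primrec.nat_sub.comp Primrec.fst Primrec.snd)
    · exact Primrec.nat_double_succ.comp
        (Primrec.nat_sub.comp (Primrec.nat_sub.comp Primrec.snd Primrec.fst) (Primrec.const 1))
  refine h.of_eq fun p => ?_
  change Equiv.intEquivNat.symm _ = (p.1 : ℤ) - p.2
  rw [Equiv.symm_apply_eq]
  split_ifs with hp
  · rw [← intEquivNat_natCast, Nat.cast_sub hp]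
  · rw [← intEquivNat_negSucc]
    congr 1
    omega

theorem primrec_int_toNat : Primrec Int.toNat := by
  have h : Primrec fun z : ℤ =>
      if Nat.bodd (Encodable.encode z) = true then 0 else Nat.div2 (Encodable.encode z) := by
    refine Primrec.ite ?_ (Primrec.const 0) (Primrec.nat_div2.comp Primrec.encode)
    exact Primrec.eq.comp (Primrec.nat_bodd.comp Primrec.encode) (Primrec.const true)
  refine h.of_eq fun z => ?_
  change (if Nat.bodd (Equiv.intEquivNat z) = true then 0
    else Nat.div2 (Equiv.intEquivNat z)) = _
  cases z with
  | ofNat n =>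
    rw [Int.ofNat_eq_natCast, intEquivNat_natCast]
    simp [Nat.div2_val]
  | negSucc n =>
    rw [intEquivNat_negSucc]
    simp

theorem primrec_int_toNat_neg : Primrec fun z : ℤ => (-z).toNat := by
  have h : Primrec fun z : ℤ =>
      if Nat.bodd (Encodable.encode z) = true then Nat.succ (Nat.div2 (Encodable.encode z))
      else 0 := by
    refine Primrec.ite ?_ (Primrec.succ.comp (Primrec.nat_div2.comp Primrec.encode))
      (Primrec.const 0)
    exact Primrec.eq.comp (Primrec.nat_bodd.comp Primrec.encode) (Primrec.const true)
  refine h.of_eq fun z => ?_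
  change (if Nat.bodd (Equiv.intEquivNat z) = true then
    Nat.succ (Nat.div2 (Equiv.intEquivNat z)) else 0) = _
  cases z with
  | ofNat n =>
    rw [Int.ofNat_eq_natCast, intEquivNat_natCast]
    simp
  | negSucc n =>
    rw [intEquivNat_negSucc]
    simp [Nat.div2_val]

theorem primrec_int_add : Primrec₂ fun a b : ℤ => a + b := by
  have h : Primrec₂ fun a b : ℤ =>
      ((a.toNat + b.toNat : ℕ) : ℤ) - ((-a).toNat + (-b).toNat : ℕ) :=
    primrec_subNatNat.comp
      (Primrec.nat_add.comp (primrec_int_toNat.comp Primrec.fst)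
        (primrec_int_toNat.comp Primrec.snd))
      (Primrec.nat_add.comp (primrec_int_toNat_neg.comp Primrec.fst)
        (primrec_int_toNat_neg.comp Primrec.snd))
  exact h.of_eq fun a b => by omega

theorem primrec_int_mul : Primrec₂ fun a b : ℤ => a * b := by
  have ha := primrec_int_toNat.comp (Primrec.fst (α := ℤ) (β := ℤ))
  have ha' := primrec_int_toNat_neg.comp (Primrec.fst (α := ℤ) (β := ℤ))
  have hb := primrec_int_toNat.comp (Primrec.snd (α := ℤ) (β := ℤ))
  have hb' := primrec_int_toNat_neg.comp (Primrec.snd (α := ℤ) (β := ℤ))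
  have h : Primrec₂ fun a b : ℤ =>
      ((a.toNat * b.toNat + (-a).toNat * (-b).toNat : ℕ) : ℤ) -
        (a.toNat * (-b).toNat + (-a).toNat * b.toNat : ℕ) :=
    primrec_subNatNat.comp
      (Primrec.nat_add.comp (Primrec.nat_mul.comp ha hb) (Primrec.nat_mul.comp ha' hb'))
      (Primrec.nat_add.comp (Primrec.nat_mul.comp ha hb') (Primrec.nat_mul.comp ha' hb))
  refine h.of_eq fun a b => ?_
  conv_rhs => rw [← Int.toNat_sub_toNat_neg a, ← Int.toNat_sub_toNat_neg b]
  push_cast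
  ring

theorem primrec_natCast_int : Primrec fun n : ℕ => (n : ℤ) :=
  (primrec_subNatNat.comp Primrec.id (Primrec.const 0)).of_eq fun n => by simp

theorem primrec_int_le : PrimrecRel fun a b : ℤ => a ≤ b := by
  have h : PrimrecRel fun a b : ℤ => a.toNat + (-b).toNat ≤ b.toNat + (-a).toNat :=
    Primrec.nat_le.comp₂
      (Primrec.nat_add.comp (primrec_int_toNat.comp Primrec.fst)
        (primrec_int_toNat_neg.comp Primrec.snd))
      (Primrec.nat_add.comp (primrec_int_toNat.comp Primrec.snd)
        (primrec_int_toNat_neg.comp Primrec.fst))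
  exact h.of_eq fun a b => by omega

theorem primrec_int_abs : Primrec fun a : ℤ => |a| := by
  refine (primrec_natCast_int.comp
    (Primrec.nat_add.comp primrec_int_toNat primrec_int_toNat_neg)).of_eq fun a => ?_
  rcases abs_cases a with h | h <;> push_cast <;> omega

end IntegerArithmetic

/-! ### Rings with primitive recursive arithmetic on codes -/

/-- A surjective coding `val : α → R` of a commutative ring by a primitively codable type, with
addition, multiplication and the test for zero primitive recursive on codes. Codes need not be
unique. Subtraction is addition of a multiple of the code `negOne` of `-1`. -/
structure CodedRing (α : Type*) [Primcodable α] (R : Type*) [CommRing R] where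
  val : α → R
  zero : α
  negOne : α
  add : α → α → α
  mul : α → α → α
  isZero : α → Bool
  val_zero : val zero = 0
  val_negOne : val negOne = -1
  val_add : ∀ a b, val (add a b) = val a + val b
  val_mul : ∀ a b, val (mul a b) = val a * val b
  isZero_iff : ∀ a, isZero a = true ↔ val a = 0
  surjective : Function.Surjective val
  primrec_add : Primrec₂ add
  primrec_mul : Primrec₂ mul
  primrec_isZero : Primrec isZero

section PolyOfCoeffs

variable {R : Type*} [CommRing R]

@[simp] theorem polyOfCoeffs_nil : polyOfCoeffs ([] : List R) = 0 := rfl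

@[simp] theorem polyOfCoeffs_cons (a : R) (l : List R) :
    polyOfCoeffs (a :: l) = C a + X * polyOfCoeffs l := rfl

theorem coeff_polyOfCoeffs (l : List R) (i : ℕ) : (polyOfCoeffs l).coeff i = l.getD i 0 := by
  induction l generalizing i with
  | nil => simp
  | cons a l ih => cases i <;> simp [ih, coeff_C]

theorem polyOfCoeffs_map {S : Type*} [CommRing S] (φ : R →+* S) (l : List R) :
    polyOfCoeffs (l.map φ) = (polyOfCoeffs l).map φ := by
  induction l with
  | nil => simp
  | cons a l ih => simp [ih]

/-- The coefficients of a polynomial, constant coefficient first. -/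
noncomputable def ascCoeffs (p : R[X]) : List R := (List.range (p.natDegree + 1)).map p.coeff

theorem polyOfCoeffs_ascCoeffs (p : R[X]) : polyOfCoeffs (ascCoeffs p) = p := by
  ext i
  rw [coeff_polyOfCoeffs, ascCoeffs]
  by_cases h : i < p.natDegree + 1
  · rw [List.getD_eq_getElem _ _ (by simpa using h)]
    simp
  · rw [List.getD_eq_default _ _ (by simpa using h), coeff_eq_zero_of_natDegree_lt (by omega)]

end PolyOfCoeffs

namespace CodedRing

variable {α R : Type*} [Primcodable α] [CommRing R] (cr : CodedRing α R)

/-- Subtraction on codes. -/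
def sub (a b : α) : α := cr.add a (cr.mul cr.negOne b)

/-- A code of `1`. -/
def one : α := cr.mul cr.negOne cr.negOne

/-- Powers on codes. -/
def pow (a : α) (n : ℕ) : α := Nat.rec cr.one (fun _ s => cr.mul a s) n

/-- Evaluation, by Horner's scheme, of a polynomial and of its derivative at `x`; the polynomial is
given by the codes of its coefficients. -/
def horner (x : α) (l : List α) : α × α :=
  l.foldr (fun a s => (cr.add a (cr.mul x s.1), cr.add s.1 (cr.mul x s.2))) (cr.zero, cr.zero)

@[simp] theorem val_sub (a b : α) : cr.val (cr.sub a b) = cr.val a - cr.val b := by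
  rw [sub, cr.val_add, cr.val_mul, cr.val_negOne]; ring

@[simp] theorem val_one : cr.val cr.one = 1 := by
  rw [one, cr.val_mul, cr.val_negOne]; ring

@[simp] theorem val_pow (a : α) (n : ℕ) : cr.val (cr.pow a n) = cr.val a ^ n := by
  induction n with
  | zero => simp [pow]
  | succ n ih => rw [pow_succ', ← ih]; exact cr.val_mul _ _

theorem val_horner (x : α) (l : List α) :
    cr.val (cr.horner x l).1 = (polyOfCoeffs (l.map cr.val)).eval (cr.val x) ∧
    cr.val (cr.horner x l).2 = (derivative (polyOfCoeffs (l.map cr.val))).eval (cr.val x) := by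
  induction l with
  | nil => simp [horner, cr.val_zero]
  | cons a l ih =>
    have h : cr.horner x (a :: l) = (cr.add a (cr.mul x (cr.horner x l).1),
      cr.add (cr.horner x l).1 (cr.mul x (cr.horner x l).2)) := rfl
    rw [h]
    simp [cr.val_add, cr.val_mul, ih.1, ih.2]

theorem primrec_sub : Primrec₂ cr.sub :=
  cr.primrec_add.comp Primrec.fst (cr.primrec_mul.comp (Primrec.const _) Primrec.snd)

theorem primrec_pow : Primrec₂ cr.pow :=
  Primrec.nat_rec (Primrec.const cr.one)
    (cr.primrec_mul.comp Primrec.fst (Primrec.snd.comp Primrec.snd)).to₂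

theorem primrec_horner : Primrec₂ cr.horner := by
  refine Primrec.list_foldr (α := α × List α) Primrec.snd (Primrec.const _)
    (h := fun p q => (cr.add q.1 (cr.mul p.1 q.2.1), cr.add q.2.1 (cr.mul p.1 q.2.2))) ?_
  have hx : Primrec fun p : (α × List α) × α × α × α => p.1.1 := Primrec.fst.comp Primrec.fst
  have ha : Primrec fun p : (α × List α) × α × α × α => p.2.1 := Primrec.fst.comp Primrec.snd
  have h1 : Primrec fun p : (α × List α) × α × α × α => p.2.2.1 :=
    Primrec.fst.comp (Primrec.snd.comp Primrec.snd)
  have h2 : Primrec fun p : (α × List α) × α × α × α => p.2.2.2 :=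
    Primrec.snd.comp (Primrec.snd.comp Primrec.snd)
  exact Primrec.pair (cr.primrec_add.comp ha (cr.primrec_mul.comp hx h1))
    (cr.primrec_add.comp h1 (cr.primrec_mul.comp hx h2))

/-- Addition of coefficient lists. -/
def listAdd (l₁ l₂ : List α) : List α :=
  (List.range (max l₁.length l₂.length)).map fun i =>
    cr.add (l₁.getD i cr.zero) (l₂.getD i cr.zero)

/-- Multiplication of coefficient lists. -/
def listMul (l₁ l₂ : List α) : List α :=
  l₁.foldr (fun a s => cr.listAdd (l₂.map (cr.mul a)) (cr.zero :: s)) []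

theorem polyOfCoeffs_listAdd (l₁ l₂ : List α) : polyOfCoeffs ((cr.listAdd l₁ l₂).map cr.val) =
    polyOfCoeffs (l₁.map cr.val) + polyOfCoeffs (l₂.map cr.val) := by
  have hget : ∀ (l : List α) (i : ℕ), (l.map cr.val).getD i 0 = cr.val (l.getD i cr.zero) := by
    intro l i
    rw [← cr.val_zero, List.getD_map]
  ext i
  rw [coeff_add, coeff_polyOfCoeffs, coeff_polyOfCoeffs, coeff_polyOfCoeffs, hget, hget, hget,
    ← cr.val_add, listAdd]
  by_cases h : i < max l₁.length l₂.length
  · rw [List.getD_eq_getElem _ _ (by simpa using h)]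
    simp
  · have h' := not_lt.1 h
    rw [List.getD_eq_default _ _ (by simpa using h'),
      List.getD_eq_default _ _ ((le_max_left _ _).trans h'),
      List.getD_eq_default _ _ ((le_max_right _ _).trans h')]
    simp [cr.val_zero, cr.val_add]

theorem polyOfCoeffs_listMul (l₁ l₂ : List α) : polyOfCoeffs ((cr.listMul l₁ l₂).map cr.val) =
    polyOfCoeffs (l₁.map cr.val) * polyOfCoeffs (l₂.map cr.val) := by
  have hsmul : ∀ a, polyOfCoeffs ((l₂.map (cr.mul a)).map cr.val) =
      C (cr.val a) * polyOfCoeffs (l₂.map cr.val) := by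
    intro a
    induction l₂ with
    | nil => simp
    | cons b l ih =>
      rw [List.map_cons, List.map_cons, polyOfCoeffs_cons, ih, cr.val_mul]
      simp; ring
  induction l₁ with
  | nil => simp [listMul]
  | cons a l ih =>
    have h : cr.listMul (a :: l) l₂ =
      cr.listAdd (l₂.map (cr.mul a)) (cr.zero :: cr.listMul l l₂) := rfl
    rw [h, polyOfCoeffs_listAdd, hsmul, List.map_cons, polyOfCoeffs_cons, ih, cr.val_zero]
    simp; ring

theorem primrec_listAdd : Primrec₂ cr.listAdd := by
  refine Primrec.list_map (α := List α × List α)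
    (g := fun p i => cr.add (p.1.getD i cr.zero) (p.2.getD i cr.zero)) ?_ ?_
  · exact Primrec.list_range.comp (Primrec.nat_max.comp
      (Primrec.list_length.comp Primrec.fst) (Primrec.list_length.comp Primrec.snd))
  · exact cr.primrec_add.comp
      ((Primrec.list_getD cr.zero).comp (Primrec.fst.comp Primrec.fst) Primrec.snd)
      ((Primrec.list_getD cr.zero).comp (Primrec.snd.comp Primrec.fst) Primrec.snd)

theorem primrec_listMul : Primrec₂ cr.listMul := by
  refine Primrec.list_foldr (α := List α × List α) Primrec.fst (Primrec.const _)
    (h := fun p q => cr.listAdd (p.2.map (cr.mul q.1)) (cr.zero :: q.2)) ?_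
  refine cr.primrec_listAdd.comp (Primrec.list_map (Primrec.snd.comp Primrec.fst) ?_)
    (Primrec.list_cons.comp (Primrec.const _) (Primrec.snd.comp Primrec.snd))
  exact cr.primrec_mul.comp (Primrec.fst.comp (Primrec.snd.comp Primrec.fst)) Primrec.snd

/-- Polynomials over a coded ring, coded by coefficient lists. -/
noncomputable def poly : CodedRing (List α) R[X] where
  val l := polyOfCoeffs (l.map cr.val)
  zero := []
  negOne := [cr.negOne]
  add := cr.listAdd
  mul := cr.listMul
  isZero l := l.foldr (fun a s => cr.isZero a && s) true
  val_zero := rfl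
  val_negOne := by simp [cr.val_negOne]
  val_add := cr.polyOfCoeffs_listAdd
  val_mul := cr.polyOfCoeffs_listMul
  isZero_iff l := by
    induction l with
    | nil => simp
    | cons a l ih =>
      rw [List.foldr_cons, Bool.and_eq_true, ih, cr.isZero_iff, List.map_cons, polyOfCoeffs_cons]
      constructor
      · rintro ⟨h1, h2⟩
        simp [h1, h2]
      · intro h
        have h0 : cr.val a = 0 := by simpa using congrArg (coeff · 0) h
        refine ⟨h0, ?_⟩
        rw [h0, C_0, zero_add] at h
        exact (isRegular_X (R := R)).left (h.trans (mul_zero X).symm)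
  surjective p := by
    obtain ⟨s, hs⟩ := cr.surjective.hasRightInverse
    refine ⟨(ascCoeffs p).map s, ?_⟩
    change polyOfCoeffs (((ascCoeffs p).map s).map cr.val) = p
    rw [List.map_map, hs.comp_eq_id, List.map_id, polyOfCoeffs_ascCoeffs]
  primrec_add := cr.primrec_listAdd
  primrec_mul := cr.primrec_listMul
  primrec_isZero := Primrec.list_foldr Primrec.id (Primrec.const _)
    (Primrec.and.comp (cr.primrec_isZero.comp (Primrec.fst.comp Primrec.snd))
      (Primrec.snd.comp Primrec.snd)).to₂

end CodedRing

/-- The rational number of a code. -/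
def RatCode.rat (r : RatCode) : ℚ := (r.1 : ℚ) / ((r.2 : ℚ) + 1)

theorem RatCode.val_eq (r : RatCode) : RatCode.val r = (RatCode.rat r : ℝ) := by
  simp [RatCode.val, RatCode.rat]

theorem RatCode.surjective_rat : Function.Surjective RatCode.rat := by
  intro q
  refine ⟨(q.num, q.den - 1), ?_⟩
  have h : ((q.den - 1 : ℕ) : ℚ) + 1 = q.den := by
    rw [Nat.cast_sub q.pos]; simp
  rw [RatCode.rat, h]
  exact Rat.num_div_den q

/-- The order on rational codes. -/
def RatCode.le (r s : RatCode) : Bool := decide (r.1 * ((s.2 : ℤ) + 1) ≤ s.1 * ((r.2 : ℤ) + 1))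

/-- The absolute value on rational codes. -/
def RatCode.abs (r : RatCode) : RatCode := (|r.1|, r.2)

theorem RatCode.le_iff (r s : RatCode) : RatCode.le r s = true ↔ r.rat ≤ s.rat := by
  rw [RatCode.le, decide_eq_true_iff, RatCode.rat, RatCode.rat,
    div_le_div_iff₀ (by positivity) (by positivity)]
  exact_mod_cast Iff.rfl

theorem RatCode.rat_abs (r : RatCode) : r.abs.rat = |r.rat| := by
  rw [RatCode.rat, RatCode.rat, abs_div, abs_of_pos (show (0 : ℚ) < (r.2 : ℚ) + 1 by positivity)]
  simp [RatCode.abs]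

theorem primrec_natCast_succ : Primrec fun n : ℕ => (n : ℤ) + 1 :=
  primrec_int_add.comp primrec_natCast_int (Primrec.const 1)

theorem RatCode.primrec_le : Primrec₂ RatCode.le := by
  refine primrec_int_le.decide.comp₂ (g := fun p q : RatCode => p.1 * ((q.2 : ℤ) + 1))
    (h := fun p q : RatCode => q.1 * ((p.2 : ℤ) + 1)) ?_ ?_
  · exact primrec_int_mul.comp (Primrec.fst.comp Primrec.fst)
      (primrec_natCast_succ.comp (Primrec.snd.comp Primrec.snd))
  · exact primrec_int_mul.comp (Primrec.fst.comp Primrec.snd)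
      (primrec_natCast_succ.comp (Primrec.snd.comp Primrec.fst))

theorem RatCode.primrec_abs : Primrec RatCode.abs :=
  Primrec.pair (primrec_int_abs.comp Primrec.fst) Primrec.snd

/-- The field of rational numbers as a coded ring. -/
def ratRing : CodedRing RatCode ℚ where
  val := RatCode.rat
  zero := (0, 0)
  negOne := (-1, 0)
  add r s := (r.1 * ((s.2 : ℤ) + 1) + s.1 * ((r.2 : ℤ) + 1), r.2 * s.2 + r.2 + s.2)
  mul r s := (r.1 * s.1, r.2 * s.2 + r.2 + s.2)
  isZero r := decide (r.1 = 0)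
  val_zero := by simp [RatCode.rat]
  val_negOne := by simp [RatCode.rat]
  val_add r s := by
    have h1 : (r.2 : ℚ) + 1 ≠ 0 := by positivity
    have h2 : (s.2 : ℚ) + 1 ≠ 0 := by positivity
    have h3 : (r.2 : ℚ) * s.2 + r.2 + s.2 + 1 = (r.2 + 1) * (s.2 + 1) := by ring
    simp only [RatCode.rat]
    push_cast
    rw [h3]
    field_simp
  val_mul r s := by
    have h3 : (r.2 : ℚ) * s.2 + r.2 + s.2 + 1 = (r.2 + 1) * (s.2 + 1) := by ring
    simp only [RatCode.rat]
    push_cast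
    rw [h3, mul_div_mul_comm]
  isZero_iff r := by
    have h1 : (r.2 : ℚ) + 1 ≠ 0 := by positivity
    simp [RatCode.rat, h1]
  surjective := RatCode.surjective_rat
  primrec_add := by
    have a1 : Primrec fun p : RatCode × RatCode => p.1.2 := Primrec.snd.comp Primrec.fst
    have a2 : Primrec fun p : RatCode × RatCode => p.2.2 := Primrec.snd.comp Primrec.snd
    exact Primrec.pair (primrec_int_add.comp
      (primrec_int_mul.comp (Primrec.fst.comp Primrec.fst) (primrec_natCast_succ.comp a2))
      (primrec_int_mul.comp (Primrec.fst.comp Primrec.snd) (primrec_natCast_succ.comp a1)))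
      (Primrec.nat_add.comp (Primrec.nat_add.comp (Primrec.nat_mul.comp a1 a2) a1) a2)
  primrec_mul := by
    have a1 : Primrec fun p : RatCode × RatCode => p.1.2 := Primrec.snd.comp Primrec.fst
    have a2 : Primrec fun p : RatCode × RatCode => p.2.2 := Primrec.snd.comp Primrec.snd
    exact Primrec.pair
      (primrec_int_mul.comp (Primrec.fst.comp Primrec.fst) (Primrec.fst.comp Primrec.snd))
      (Primrec.nat_add.comp (Primrec.nat_add.comp (Primrec.nat_mul.comp a1 a2) a1) a2)
  primrec_isZero := (Primrec.eq (α := ℤ)).decide.comp Primrec.fst (Primrec.const 0)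

/-! ### Verifiable certificates with algebraic coefficients -/

/-- The ring `ℚ[T]`, coded by lists of rational codes. The variable `T` stands for a real number
in `[-1, 1]` that generates a number field containing all the coefficients in question. -/
noncomputable def ratPolyRing : CodedRing (List RatCode) ℚ[X] := ratRing.poly

/-- The ring `ℚ[T][X]`. -/
noncomputable def ratPolyPolyRing : CodedRing (List (List RatCode)) ℚ[X][X] := ratPolyRing.poly

/-- The sum of the absolute values of the coefficients. -/
def absSum (A : List RatCode) : RatCode :=
  A.foldr (fun a s => ratRing.add a.abs s) ratRing.zero

/-- The constant coefficient dominates the sum of the absolute values of the others, so that the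
polynomial is positive on `[-1, 1]`. -/
def isPositive (A : List RatCode) : Bool :=
  !RatCode.le (A.getD 0 ratRing.zero) (absSum A.tail)

/-- A sufficient condition, on the coefficients of `A`, for `A` to map `[-1, 1]` into
`[lo, hi]`. -/
def mapsInto (A : List RatCode) (I : RatCode × RatCode) : Bool :=
  RatCode.le (ratRing.add I.1 (absSum A.tail)) (A.getD 0 ratRing.zero) &&
    RatCode.le (ratRing.add (A.getD 0 ratRing.zero) (absSum A.tail)) I.2

/-- `P` changes sign between `-1` and `1`, or vanishes at one of them. -/
def changesSign (P : List RatCode) : Bool :=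
  RatCode.le (ratRing.mul (ratRing.horner ratRing.negOne P).1 (ratRing.horner ratRing.one P).1)
    ratRing.zero

/-- Integers as constant polynomials in `T`. -/
def constCoeffs (q : List ℤ) : List (List RatCode) := q.map fun z => [(z, 0)]

/-- An algebraic code, a polynomial `A(T)` for the number it represents, and the
quotient of `a(A(T))` by the modulus `P(T)`, where `a` is the polynomial of the code. -/
abbrev LinkedCode : Type := AlgCode × List RatCode × List RatCode

instance LinkedCode.primcodable : Primcodable LinkedCode := inferInstance

/-- If `θ ∈ [-1, 1]` is a root of `P`, then `A(θ)` is a root of the polynomial of the code and lies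
in the interval of the code. -/
noncomputable def isLinked (w : LinkedCode) (P : List RatCode) : Bool :=
  ratPolyRing.isZero (ratPolyRing.sub (ratPolyRing.horner w.2.1 (constCoeffs w.1.1)).1
    (ratPolyRing.mul P w.2.2)) && mapsInto w.2.1 w.1.2

/-- The affine map from `[-1, 1]` onto the interval of a code. -/
def intervalChart (I : RatCode × RatCode) : List RatCode :=
  [ratRing.mul (1, 1) (ratRing.add I.1 I.2), ratRing.mul (1, 1) (ratRing.sub I.2 I.1)]

/-- The polynomial of the code has positive derivative on the interval of the code, hence at most
one root there. -/
noncomputable def isIsolating (a : AlgCode) : Bool :=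
  isPositive (ratPolyRing.horner (intervalChart a.2) (constCoeffs a.1)).2

-- An intermediate step for the instance on `Witness`, whose nesting is too deep for direct search.
instance LinkedCode.primcodableQuadruple : Primcodable
    ((List LinkedCode × List LinkedCode) × (List LinkedCode × List LinkedCode)) :=
  inferInstance

/-- The data of a verifiable certificate: a modulus `P(T)`, the linked codes of `d` and `c`, the
linked codes of the coefficients of `f` and of the four polynomials to be squared, and the
quotient by `P` of the difference of the two sides of the certificate. -/
abbrev Witness : Type :=
  List RatCode × (LinkedCode × LinkedCode) × List LinkedCode ×
    ((List LinkedCode × List LinkedCode) × (List LinkedCode × List LinkedCode)) ×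
    List (List RatCode)

instance Witness.primcodable : Primcodable Witness := inferInstance

/-- A code of `f`, codes of `d` and `c`, and the exponents `m` and `n`. -/
abbrev Input : Type := PolyCode × AlgCode × AlgCode × ℕ × ℕ

namespace Witness

/-- The modulus `P(T)`. -/
def modulus (w : Witness) : List RatCode := w.1
/-- The linked code of `d`. -/
def left (w : Witness) : LinkedCode := w.2.1.1
/-- The linked code of `c`. -/
def right (w : Witness) : LinkedCode := w.2.1.2
/-- The linked codes of the coefficients of `f`. -/
def poly (w : Witness) : List LinkedCode := w.2.2.1
/-- The first square of `σ₀`. -/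
def sq₁ (w : Witness) : List LinkedCode := w.2.2.2.1.1.1
/-- The second square of `σ₀`. -/
def sq₂ (w : Witness) : List LinkedCode := w.2.2.2.1.1.2
/-- The first square of `σ₁`. -/
def sq₃ (w : Witness) : List LinkedCode := w.2.2.2.1.2.1
/-- The second square of `σ₁`. -/
def sq₄ (w : Witness) : List LinkedCode := w.2.2.2.1.2.2
/-- The quotient by the modulus. -/
def quotient (w : Witness) : List (List RatCode) := w.2.2.2.2

/-- The linked codes of the coefficients of the output. -/
def outputs (w : Witness) : List LinkedCode := w.sq₁ ++ w.sq₂ ++ (w.sq₃ ++ w.sq₄)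

/-- All linked codes of a witness. -/
def links (w : Witness) : List LinkedCode := w.left :: w.right :: (w.poly ++ w.outputs)

/-- The codes of the two sums of squares. -/
def result (w : Witness) : SosCode × SosCode :=
  ([w.sq₁.map Prod.fst, w.sq₂.map Prod.fst], [w.sq₃.map Prod.fst, w.sq₄.map Prod.fst])

end Witness

/-- The polynomial over `ℚ[T]` given by a list of linked codes. -/
def lift (l : List LinkedCode) : List (List RatCode) := l.map fun w => w.2.1

/-- The code of `X - A(T)`. -/
noncomputable def linearFactor (A : List RatCode) : List (List RatCode) :=
  [ratPolyRing.mul ratPolyRing.negOne A, ratPolyRing.one]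

/-- The code of `A² + B²`. -/
noncomputable def sumSq (A B : List (List RatCode)) : List (List RatCode) :=
  ratPolyPolyRing.add (ratPolyPolyRing.mul A A) (ratPolyPolyRing.mul B B)

/-- The left hand side `(X - d) ^ m (X - c) ^ (n + 1)` over `ℚ[T]`. -/
noncomputable def certLeft (i : Input) (w : Witness) : List (List RatCode) :=
  ratPolyPolyRing.mul (ratPolyPolyRing.pow (linearFactor w.left.2.1) i.2.2.2.1)
    (ratPolyPolyRing.pow (linearFactor w.right.2.1) (i.2.2.2.2 + 1))

/-- The right hand side `σ₀ + σ₁ f + P H` over `ℚ[T]`. -/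
noncomputable def certRight (w : Witness) : List (List RatCode) :=
  ratPolyPolyRing.add (sumSq (lift w.sq₁) (lift w.sq₂))
    (ratPolyPolyRing.add (ratPolyPolyRing.mul (sumSq (lift w.sq₃) (lift w.sq₄)) (lift w.poly))
      (ratPolyPolyRing.mul [w.modulus] w.quotient))

/-- The conditions under which a witness proves that its result is correct for the input. -/
def Verifies (i : Input) (w : Witness) : Prop :=
  ((w.poly.map Prod.fst = i.1 ∧ w.left.1 = i.2.1 ∧ w.right.1 = i.2.2.1) ∧
    changesSign w.modulus = true) ∧
  ((∀ l ∈ w.links, isLinked l w.modulus = true) ∧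
    ∀ a ∈ w.outputs.map Prod.fst, isIsolating a = true) ∧
  ratPolyPolyRing.isZero (ratPolyPolyRing.sub (certLeft i w) (certRight w)) = true

section Primrec

theorem primrec_absSum : Primrec absSum :=
  Primrec.list_foldr Primrec.id (Primrec.const _)
    (ratRing.primrec_add.comp (RatCode.primrec_abs.comp (Primrec.fst.comp Primrec.snd))
      (Primrec.snd.comp Primrec.snd)).to₂

theorem primrec_getD_zero : Primrec fun A : List RatCode => A.getD 0 ratRing.zero :=
  (Primrec.list_getD _).comp Primrec.id (Primrec.const 0)

theorem primrec_isPositive : Primrec isPositive :=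
  Primrec.not.comp (RatCode.primrec_le.comp primrec_getD_zero
    (primrec_absSum.comp Primrec.list_tail))

theorem primrec_mapsInto : Primrec₂ mapsInto := by
  have h0 : Primrec fun p : List RatCode × RatCode × RatCode => p.1.getD 0 ratRing.zero :=
    primrec_getD_zero.comp Primrec.fst
  have h1 : Primrec fun p : List RatCode × RatCode × RatCode => absSum p.1.tail :=
    primrec_absSum.comp (Primrec.list_tail.comp Primrec.fst)
  exact Primrec.and.comp
    (RatCode.primrec_le.comp (ratRing.primrec_add.comp (Primrec.fst.comp Primrec.snd) h1) h0)
    (RatCode.primrec_le.comp (ratRing.primrec_add.comp h0 h1) (Primrec.snd.comp Primrec.snd))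

theorem primrec_changesSign : Primrec changesSign :=
  RatCode.primrec_le.comp (ratRing.primrec_mul.comp
    (Primrec.fst.comp (ratRing.primrec_horner.comp (Primrec.const _) Primrec.id))
    (Primrec.fst.comp (ratRing.primrec_horner.comp (Primrec.const _) Primrec.id)))
    (Primrec.const _)

theorem primrec_constCoeffs : Primrec constCoeffs :=
  Primrec.list_map Primrec.id (Primrec.list_cons.comp
    (Primrec.pair Primrec.snd (Primrec.const 0)) (Primrec.const [])).to₂

theorem primrec_isLinked : Primrec₂ isLinked := by
  have hA : Primrec fun p : LinkedCode × List RatCode => p.1.2.1 :=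
    Primrec.fst.comp (Primrec.snd.comp Primrec.fst)
  have hQ : Primrec fun p : LinkedCode × List RatCode => p.1.2.2 :=
    Primrec.snd.comp (Primrec.snd.comp Primrec.fst)
  have ha : Primrec fun p : LinkedCode × List RatCode => p.1.1 := Primrec.fst.comp Primrec.fst
  exact Primrec.and.comp
    (ratPolyRing.primrec_isZero.comp (ratPolyRing.primrec_sub.comp
      (Primrec.fst.comp (ratPolyRing.primrec_horner.comp hA
        (primrec_constCoeffs.comp (Primrec.fst.comp ha))))
      (ratPolyRing.primrec_mul.comp Primrec.snd hQ)))
    (primrec_mapsInto.comp hA (Primrec.snd.comp ha))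

theorem primrec_intervalChart : Primrec intervalChart :=
  Primrec.list_cons.comp
    (ratRing.primrec_mul.comp (Primrec.const _)
      (ratRing.primrec_add.comp Primrec.fst Primrec.snd))
    (Primrec.list_cons.comp (ratRing.primrec_mul.comp (Primrec.const _)
      (ratRing.primrec_sub.comp Primrec.snd Primrec.fst)) (Primrec.const []))

theorem primrec_isIsolating : Primrec isIsolating :=
  primrec_isPositive.comp (Primrec.snd.comp (ratPolyRing.primrec_horner.comp
    (primrec_intervalChart.comp Primrec.snd) (primrec_constCoeffs.comp Primrec.fst)))

theorem primrec_lift : Primrec lift :=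
  Primrec.list_map Primrec.id (Primrec.fst.comp (Primrec.snd.comp Primrec.snd)).to₂

theorem primrec_codes : Primrec fun l : List LinkedCode => l.map Prod.fst :=
  Primrec.list_map Primrec.id (Primrec.fst.comp Primrec.snd).to₂

theorem primrec_linearFactor : Primrec linearFactor :=
  Primrec.list_cons.comp (ratPolyRing.primrec_mul.comp (Primrec.const _) Primrec.id)
    (Primrec.const _)

theorem primrec_sumSq : Primrec₂ sumSq :=
  ratPolyPolyRing.primrec_add.comp (ratPolyPolyRing.primrec_mul.comp Primrec.fst Primrec.fst)
    (ratPolyPolyRing.primrec_mul.comp Primrec.snd Primrec.snd)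

namespace Witness

theorem primrec_modulus : Primrec modulus := Primrec.fst

theorem primrec_left : Primrec left := Primrec.fst.comp (Primrec.fst.comp Primrec.snd)

theorem primrec_right : Primrec right := Primrec.snd.comp (Primrec.fst.comp Primrec.snd)

theorem primrec_poly : Primrec poly := Primrec.fst.comp (Primrec.snd.comp Primrec.snd)

theorem primrec_squares : Primrec fun w : Witness => w.2.2.2.1 :=
  Primrec.fst.comp (Primrec.snd.comp (Primrec.snd.comp Primrec.snd))

theorem primrec_sq₁ : Primrec sq₁ := Primrec.fst.comp (Primrec.fst.comp primrec_squares)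

theorem primrec_sq₂ : Primrec sq₂ := Primrec.snd.comp (Primrec.fst.comp primrec_squares)

theorem primrec_sq₃ : Primrec sq₃ := Primrec.fst.comp (Primrec.snd.comp primrec_squares)

theorem primrec_sq₄ : Primrec sq₄ := Primrec.snd.comp (Primrec.snd.comp primrec_squares)

theorem primrec_quotient : Primrec quotient :=
  Primrec.snd.comp (Primrec.snd.comp (Primrec.snd.comp Primrec.snd))

theorem primrec_outputs : Primrec outputs :=
  Primrec.list_append.comp (Primrec.list_append.comp primrec_sq₁ primrec_sq₂)
    (Primrec.list_append.comp primrec_sq₃ primrec_sq₄)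

theorem primrec_links : Primrec links :=
  Primrec.list_cons.comp primrec_left (Primrec.list_cons.comp primrec_right
    (Primrec.list_append.comp primrec_poly primrec_outputs))

theorem primrec_result : Primrec result := by
  have h : ∀ {f g : Witness → List LinkedCode}, Primrec f → Primrec g →
      Primrec fun w => [(f w).map Prod.fst, (g w).map Prod.fst] := fun hf hg =>
    Primrec.list_cons.comp (primrec_codes.comp hf)
      (Primrec.list_cons.comp (primrec_codes.comp hg) (Primrec.const []))
  exact Primrec.pair (h primrec_sq₁ primrec_sq₂) (h primrec_sq₃ primrec_sq₄)

end Witness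

theorem primrec_certLeft : Primrec₂ certLeft := by
  have he : Primrec fun p : Input × Witness => p.1.2.2.2 :=
    Primrec.snd.comp (Primrec.snd.comp (Primrec.snd.comp Primrec.fst))
  have hd : Primrec fun p : Input × Witness => linearFactor p.2.left.2.1 :=
    primrec_linearFactor.comp
      (Primrec.fst.comp (Primrec.snd.comp (Witness.primrec_left.comp Primrec.snd)))
  have hc : Primrec fun p : Input × Witness => linearFactor p.2.right.2.1 :=
    primrec_linearFactor.comp
      (Primrec.fst.comp (Primrec.snd.comp (Witness.primrec_right.comp Primrec.snd)))
  exact ratPolyPolyRing.primrec_mul.comp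
    (ratPolyPolyRing.primrec_pow.comp hd (Primrec.fst.comp he))
    (ratPolyPolyRing.primrec_pow.comp hc (Primrec.succ.comp (Primrec.snd.comp he)))

theorem primrec_certRight : Primrec certRight :=
  ratPolyPolyRing.primrec_add.comp
    (primrec_sumSq.comp (primrec_lift.comp Witness.primrec_sq₁)
      (primrec_lift.comp Witness.primrec_sq₂))
    (ratPolyPolyRing.primrec_add.comp
      (ratPolyPolyRing.primrec_mul.comp
        (primrec_sumSq.comp (primrec_lift.comp Witness.primrec_sq₃)
          (primrec_lift.comp Witness.primrec_sq₄))
        (primrec_lift.comp Witness.primrec_poly))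
      (ratPolyPolyRing.primrec_mul.comp
        (Primrec.list_cons.comp Witness.primrec_modulus (Primrec.const []))
        Witness.primrec_quotient))

theorem primrec_verifies : PrimrecPred fun p : Input × Witness => Verifies p.1 p.2 := by
  have hw : ∀ {β : Type} [Primcodable β] {f : Witness → β}, Primrec f →
      Primrec fun p : Input × Witness => f p.2 := fun hf => hf.comp Primrec.snd
  refine PrimrecPred.and (PrimrecPred.and (PrimrecPred.and ?_ (PrimrecPred.and ?_ ?_)) ?_)
    (PrimrecPred.and (PrimrecPred.and ?_ ?_) ?_)
  · exact Primrec.eq.comp (primrec_codes.comp (hw Witness.primrec_poly))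
      (Primrec.fst.comp Primrec.fst)
  · exact Primrec.eq.comp (Primrec.fst.comp (hw Witness.primrec_left))
      (Primrec.fst.comp (Primrec.snd.comp Primrec.fst))
  · exact Primrec.eq.comp (Primrec.fst.comp (hw Witness.primrec_right))
      (Primrec.fst.comp (Primrec.snd.comp (Primrec.snd.comp Primrec.fst)))
  · exact Primrec.eq.comp (primrec_changesSign.comp (hw Witness.primrec_modulus))
      (Primrec.const true)
  · have h : PrimrecRel fun (l : LinkedCode) (P : List RatCode) => isLinked l P = true :=
      Primrec.eq.comp₂ primrec_isLinked (Primrec₂.const true)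
    exact h.forall_mem_list.comp (hw Witness.primrec_links) (hw Witness.primrec_modulus)
  · have h : PrimrecPred fun a : AlgCode => isIsolating a = true :=
      Primrec.eq.comp primrec_isIsolating (Primrec.const true)
    exact h.forall_mem_list.comp (primrec_codes.comp (hw Witness.primrec_outputs))
  · exact Primrec.eq.comp (ratPolyPolyRing.primrec_isZero.comp
      (ratPolyPolyRing.primrec_sub.comp primrec_certLeft (hw primrec_certRight)))
      (Primrec.const true)

open Classical in
/-- The search for a verified witness. -/
noncomputable def searchCertificate (i : Input) : Part (SosCode × SosCode) :=
  Nat.rfindOpt fun k => (Encodable.decode (α := Witness) k).bind fun w =>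
    if Verifies i w then some w.result else none

theorem partrec_searchCertificate : Partrec searchCertificate := by
  classical
  refine Partrec.rfindOpt (Primrec.to_comp ?_)
  refine Primrec.option_bind (α := Input × ℕ) (Primrec.decode.comp Primrec.snd) ?_
  refine Primrec.ite (c := fun p : (Input × ℕ) × Witness => Verifies p.1.1 p.2) ?_
    (Primrec.option_some.comp (Witness.primrec_result.comp Primrec.snd)) (Primrec.const none)
  exact primrec_verifies.comp (Primrec.pair (Primrec.fst.comp Primrec.fst) Primrec.snd)

end Primrec

theorem searchCertificate_spec {i : Input} {w : Witness} (hw : Verifies i w) :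
    ∃ w', Verifies i w' ∧ w'.result ∈ searchCertificate i := by
  classical
  have hdom : (searchCertificate i).Dom :=
    Nat.rfindOpt_dom.2 ⟨Encodable.encode w, w.result, by simp [hw]⟩
  obtain ⟨k, hk⟩ := Nat.rfindOpt_spec (Part.get_mem hdom)
  rw [Option.mem_def, Option.bind_eq_some_iff] at hk
  obtain ⟨w', -, h⟩ := hk
  split_ifs at h with hv
  refine ⟨w', hv, ?_⟩
  rw [Option.some.inj h]
  exact Part.get_mem hdom

/-! ### Verified witnesses yield certificates -/

theorem ratPolyRing_val_cons (a : RatCode) (A : List RatCode) :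
    ratPolyRing.val (a :: A) = C a.rat + X * ratPolyRing.val A := rfl

theorem ratPolyRing_val_eq_head_add (A : List RatCode) : ratPolyRing.val A =
    C (A.getD 0 ratRing.zero).rat + X * ratPolyRing.val A.tail := by
  cases A with
  | nil =>
    change (0 : ℚ[X]) = C (ratRing.val ratRing.zero) + X * 0
    rw [ratRing.val_zero]; simp
  | cons a A => rfl

theorem rat_add (r s : RatCode) : (ratRing.add r s).rat = r.rat + s.rat := ratRing.val_add r s

theorem rat_mul (r s : RatCode) : (ratRing.mul r s).rat = r.rat * s.rat := ratRing.val_mul r s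

theorem rat_sub (r s : RatCode) : (ratRing.sub r s).rat = r.rat - s.rat := ratRing.val_sub r s

theorem rat_zero : ratRing.zero.rat = 0 := ratRing.val_zero

theorem rat_one : ratRing.one.rat = 1 := ratRing.val_one

theorem rat_negOne : ratRing.negOne.rat = -1 := ratRing.val_negOne

theorem rat_absSum_cons (a : RatCode) (A : List RatCode) :
    (absSum (a :: A)).rat = |a.rat| + (absSum A).rat := by
  rw [← RatCode.rat_abs, ← rat_add]; rfl

theorem abs_aeval_le_absSum {t : ℝ} (ht : |t| ≤ 1) (A : List RatCode) :
    |aeval t (ratPolyRing.val A)| ≤ ((absSum A).rat : ℝ) := by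
  induction A with
  | nil =>
    change |aeval t (0 : ℚ[X])| ≤ ((ratRing.zero.rat : ℚ) : ℝ)
    rw [rat_zero]; simp
  | cons a A ih =>
    rw [ratPolyRing_val_cons, rat_absSum_cons]
    simp only [map_add, map_mul, aeval_C, aeval_X, eq_ratCast]
    push_cast
    refine (abs_add_le _ _).trans (add_le_add le_rfl ?_)
    rw [abs_mul]
    calc |t| * |aeval t (ratPolyRing.val A)| ≤ 1 * |aeval t (ratPolyRing.val A)| := by gcongr
      _ ≤ _ := by rw [one_mul]; exact ih

theorem abs_aeval_sub_head_le {t : ℝ} (ht : |t| ≤ 1) (A : List RatCode) :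
    |aeval t (ratPolyRing.val A) - (A.getD 0 ratRing.zero).rat| ≤
      ((absSum A.tail).rat : ℝ) := by
  rw [ratPolyRing_val_eq_head_add]
  simp only [map_add, map_mul, aeval_C, aeval_X, eq_ratCast, add_sub_cancel_left]
  rw [abs_mul]
  calc |t| * |aeval t (ratPolyRing.val A.tail)|
      ≤ 1 * |aeval t (ratPolyRing.val A.tail)| := by gcongr
    _ ≤ _ := by rw [one_mul]; exact abs_aeval_le_absSum ht _

theorem mapsInto_iff (A : List RatCode) (I : RatCode × RatCode) : mapsInto A I = true ↔
    I.1.rat + (absSum A.tail).rat ≤ (A.getD 0 ratRing.zero).rat ∧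
      (A.getD 0 ratRing.zero).rat + (absSum A.tail).rat ≤ I.2.rat := by
  rw [mapsInto, Bool.and_eq_true, RatCode.le_iff, RatCode.le_iff, rat_add, rat_add]

theorem isPositive_iff (A : List RatCode) : isPositive A = true ↔
    (absSum A.tail).rat < (A.getD 0 ratRing.zero).rat := by
  rw [isPositive, Bool.not_eq_true', ← not_le, ← RatCode.le_iff, Bool.not_eq_true]

theorem aeval_mem_Icc_of_mapsInto {A : List RatCode} {I : RatCode × RatCode}
    (h : mapsInto A I = true) {t : ℝ} (ht : |t| ≤ 1) :
    aeval t (ratPolyRing.val A) ∈ Set.Icc (RatCode.val I.1) (RatCode.val I.2) := by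
  obtain ⟨h1, h2⟩ := (mapsInto_iff A I).1 h
  have h1' : (I.1.rat : ℝ) + (absSum A.tail).rat ≤ (A.getD 0 ratRing.zero).rat := by
    exact_mod_cast h1
  have h2' : ((A.getD 0 ratRing.zero).rat : ℝ) + (absSum A.tail).rat ≤ I.2.rat := by
    exact_mod_cast h2
  have h3 := abs_le.1 (abs_aeval_sub_head_le ht A)
  rw [RatCode.val_eq, RatCode.val_eq]
  constructor <;> linarith [h3.1, h3.2]

theorem aeval_pos_of_isPositive {A : List RatCode} (h : isPositive A = true) {t : ℝ}
    (ht : |t| ≤ 1) : 0 < aeval t (ratPolyRing.val A) := by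
  have h1 : ((absSum A.tail).rat : ℝ) < (A.getD 0 ratRing.zero).rat := by
    exact_mod_cast (isPositive_iff A).1 h
  linarith [(abs_le.1 (abs_aeval_sub_head_le ht A)).1]

theorem polyOfCoeffs_constCoeffs (q : List ℤ) :
    polyOfCoeffs ((constCoeffs q).map ratPolyRing.val) =
      (polyOfCoeffs q).map (algebraMap ℤ ℚ[X]) := by
  rw [← polyOfCoeffs_map, constCoeffs, List.map_map]
  congr 2
  funext z
  change C (RatCode.rat (z, 0)) + X * 0 = _
  simp [RatCode.rat]

theorem val_horner_constCoeffs (A : List RatCode) (q : List ℤ) :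
    ratPolyRing.val (ratPolyRing.horner A (constCoeffs q)).1 =
      aeval (ratPolyRing.val A) (polyOfCoeffs q) ∧
    ratPolyRing.val (ratPolyRing.horner A (constCoeffs q)).2 =
      aeval (ratPolyRing.val A) (derivative (polyOfCoeffs q)) := by
  have h := ratPolyRing.val_horner A (constCoeffs q)
  rw [polyOfCoeffs_constCoeffs, derivative_map, eval_map_algebraMap, eval_map_algebraMap] at h
  exact h

theorem isLinked_iff (w : LinkedCode) (P : List RatCode) : isLinked w P = true ↔
    aeval (ratPolyRing.val w.2.1) (polyOfCoeffs w.1.1) =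
      ratPolyRing.val P * ratPolyRing.val w.2.2 ∧ mapsInto w.2.1 w.1.2 = true := by
  rw [isLinked, Bool.and_eq_true, ratPolyRing.isZero_iff, ratPolyRing.val_sub,
    ratPolyRing.val_mul, (val_horner_constCoeffs _ _).1, sub_eq_zero]

theorem aeval_aeval_int (θ : ℝ) (p : ℚ[X]) (q : ℤ[X]) :
    aeval (aeval θ p) q = aeval θ (aeval p q) :=
  (aeval_algHom_apply ((aeval θ : ℚ[X] →ₐ[ℚ] ℝ).restrictScalars ℤ) p q)

/-- The real number of a linked code, for the value `θ` of the variable. -/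
noncomputable def LinkedCode.value (θ : ℝ) (w : LinkedCode) : ℝ := aeval θ (ratPolyRing.val w.2.1)

theorem LinkedCode.value_isRoot {w : LinkedCode} {P : List RatCode} (hw : isLinked w P = true)
    {θ : ℝ} (hθ : |θ| ≤ 1) (hP : aeval θ (ratPolyRing.val P) = 0) :
    w.value θ ∈ Set.Icc (RatCode.val w.1.2.1) (RatCode.val w.1.2.2) ∧
      aeval (w.value θ) (polyOfCoeffs w.1.1) = 0 := by
  obtain ⟨h1, h2⟩ := (isLinked_iff w P).1 hw
  refine ⟨aeval_mem_Icc_of_mapsInto h2 hθ, ?_⟩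
  rw [LinkedCode.value, aeval_aeval_int, h1, map_mul, hP, zero_mul]

theorem val_intervalChart (I : RatCode × RatCode) : ratPolyRing.val (intervalChart I) =
    C ((I.1.rat + I.2.rat) / 2) + C ((I.2.rat - I.1.rat) / 2) * X := by
  have half : RatCode.rat (1, 1) = 1 / 2 := by norm_num [RatCode.rat]
  change C (RatCode.rat (ratRing.mul (1, 1) (ratRing.add I.1 I.2))) +
    X * (C (RatCode.rat (ratRing.mul (1, 1) (ratRing.sub I.2 I.1))) + X * 0) = _
  rw [rat_mul, rat_mul, rat_add, rat_sub, half, mul_zero, add_zero, mul_comm X,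
    one_div_mul_eq_div, one_div_mul_eq_div]

theorem isIsolating_unique {a : AlgCode} (ha : isIsolating a = true) {x : ℝ}
    (hx : x ∈ Set.Icc (RatCode.val a.2.1) (RatCode.val a.2.2))
    (hroot : aeval x (polyOfCoeffs a.1) = 0) : AlgCode.Represents a x := by
  have hder : ∀ y ∈ Set.Icc (RatCode.val a.2.1) (RatCode.val a.2.2),
      0 < aeval y (derivative (polyOfCoeffs a.1)) := by
    intro y hy
    obtain ⟨t, ht, hty⟩ : ∃ t : ℝ, |t| ≤ 1 ∧
        aeval t (ratPolyRing.val (intervalChart a.2)) = y := by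
      rw [val_intervalChart]
      simp only [map_add, map_mul, aeval_C, aeval_X, eq_ratCast]
      rw [RatCode.val_eq, RatCode.val_eq] at hy
      push_cast
      rcases (hy.1.trans hy.2).lt_or_eq with h | h
      · have h0 : 0 < ((a.2.2.rat : ℝ) - a.2.1.rat) := by linarith
        refine ⟨(2 * y - a.2.1.rat - a.2.2.rat) / (a.2.2.rat - a.2.1.rat), ?_, ?_⟩
        · rw [abs_le, le_div_iff₀ h0, div_le_iff₀ h0]
          constructor <;> linarith [hy.1, hy.2]
        · field_simp
          ring
      · refine ⟨0, by simp, ?_⟩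
        linarith [hy.1, hy.2]
    have h1 := aeval_pos_of_isPositive ha ht
    rwa [(val_horner_constCoeffs _ _).2, ← aeval_aeval_int, hty] at h1
  have hmono : StrictMonoOn (fun y : ℝ => aeval y (polyOfCoeffs a.1))
      (Set.Icc (RatCode.val a.2.1) (RatCode.val a.2.2)) := by
    refine strictMonoOn_of_deriv_pos (convex_Icc _ _) (by fun_prop) fun y hy => ?_
    rw [Polynomial.deriv_aeval]
    exact hder y (interior_subset hy)
  refine ⟨fun h => ?_, hx, hroot, fun y hy h => hmono.injOn hy hx (h.trans hroot.symm)⟩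
  have := hder x hx
  rw [h] at this
  simp at this

theorem exists_root_of_changesSign {P : List RatCode} (hP : changesSign P = true) :
    ∃ θ : ℝ, |θ| ≤ 1 ∧ aeval θ (ratPolyRing.val P) = 0 := by
  have hval : ∀ r : RatCode, ((ratRing.horner r P).1.rat : ℝ) =
      aeval ((r.rat : ℚ) : ℝ) (ratPolyRing.val P) := by
    intro r
    have h1 := (ratRing.val_horner r P).1
    have h2 := aeval_algebraMap_apply_eq_algebraMap_eval (A := ℝ) r.rat (ratPolyRing.val P)
    rw [eq_ratCast, eq_ratCast] at h2
    rw [h2]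
    exact congrArg _ h1
  rw [changesSign, RatCode.le_iff, rat_mul, rat_zero] at hP
  have h : aeval (-1 : ℝ) (ratPolyRing.val P) * aeval (1 : ℝ) (ratPolyRing.val P) ≤ 0 := by
    have h1 := hval ratRing.negOne
    have h2 := hval ratRing.one
    rw [rat_negOne] at h1
    rw [rat_one] at h2
    push_cast at h1 h2
    rw [← h1, ← h2]
    exact_mod_cast hP
  have hcont : ContinuousOn (fun t : ℝ => aeval t (ratPolyRing.val P)) (Set.uIcc (-1) 1) := by
    fun_prop
  have h0 : (0 : ℝ) ∈ Set.uIcc (aeval (-1 : ℝ) (ratPolyRing.val P))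
      (aeval (1 : ℝ) (ratPolyRing.val P)) := by
    rw [Set.mem_uIcc]
    rcases mul_nonpos_iff.1 h with h | h
    · exact Or.inr ⟨h.2, h.1⟩
    · exact Or.inl h
  obtain ⟨θ, hθ, h⟩ := intermediate_value_uIcc hcont h0
  rw [Set.uIcc_of_le (by norm_num)] at hθ
  exact ⟨θ, abs_le.2 hθ, h⟩

theorem ratPolyPolyRing_val (l : List (List RatCode)) :
    ratPolyPolyRing.val l = polyOfCoeffs (l.map ratPolyRing.val) := rfl

theorem map_val_lift (θ : ℝ) (l : List LinkedCode) :
    mapRingHom (aeval θ : ℚ[X] →ₐ[ℚ] ℝ).toRingHom (ratPolyPolyRing.val (lift l)) =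
      polyOfCoeffs (l.map (LinkedCode.value θ)) := by
  rw [ratPolyPolyRing_val, coe_mapRingHom, ← polyOfCoeffs_map, lift, List.map_map, List.map_map]
  rfl

theorem val_linearFactor (A : List RatCode) :
    ratPolyPolyRing.val (linearFactor A) = X - C (ratPolyRing.val A) := by
  rw [ratPolyPolyRing_val, linearFactor]
  simp [ratPolyRing.val_mul, ratPolyRing.val_negOne, sub_eq_neg_add]

theorem val_sumSq (A B : List (List RatCode)) : ratPolyPolyRing.val (sumSq A B) =
    ratPolyPolyRing.val A ^ 2 + ratPolyPolyRing.val B ^ 2 := by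
  rw [sumSq, ratPolyPolyRing.val_add, ratPolyPolyRing.val_mul, ratPolyPolyRing.val_mul, sq, sq]

theorem val_certLeft (i : Input) (w : Witness) : ratPolyPolyRing.val (certLeft i w) =
    (X - C (ratPolyRing.val w.left.2.1)) ^ i.2.2.2.1 *
      (X - C (ratPolyRing.val w.right.2.1)) ^ (i.2.2.2.2 + 1) := by
  rw [certLeft, ratPolyPolyRing.val_mul, ratPolyPolyRing.val_pow, ratPolyPolyRing.val_pow,
    val_linearFactor, val_linearFactor]

theorem val_certRight (w : Witness) : ratPolyPolyRing.val (certRight w) =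
    (ratPolyPolyRing.val (lift w.sq₁) ^ 2 + ratPolyPolyRing.val (lift w.sq₂) ^ 2) +
      ((ratPolyPolyRing.val (lift w.sq₃) ^ 2 + ratPolyPolyRing.val (lift w.sq₄) ^ 2) *
        ratPolyPolyRing.val (lift w.poly) +
      C (ratPolyRing.val w.modulus) * ratPolyPolyRing.val w.quotient) := by
  have h : ratPolyPolyRing.val [w.modulus] = C (ratPolyRing.val w.modulus) := by
    rw [ratPolyPolyRing_val]; simp
  rw [certRight, ratPolyPolyRing.val_add, ratPolyPolyRing.val_add, ratPolyPolyRing.val_mul,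
    ratPolyPolyRing.val_mul, val_sumSq, val_sumSq, h]

theorem AlgCode.Represents.value_eq {w : LinkedCode} {x : ℝ} (hx : AlgCode.Represents w.1 x)
    {P : List RatCode} (hw : isLinked w P = true) {θ : ℝ} (hθ : |θ| ≤ 1)
    (hP : aeval θ (ratPolyRing.val P) = 0) : w.value θ = x :=
  hx.2.2.2 _ (LinkedCode.value_isRoot hw hθ hP).1 (LinkedCode.value_isRoot hw hθ hP).2

theorem map_value_eq_of_represents {l : List LinkedCode} {as : List ℝ}
    (h : List.Forall₂ AlgCode.Represents (l.map Prod.fst) as) {P : List RatCode}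
    (hl : ∀ w ∈ l, isLinked w P = true) {θ : ℝ} (hθ : |θ| ≤ 1)
    (hP : aeval θ (ratPolyRing.val P) = 0) : l.map (LinkedCode.value θ) = as := by
  induction l generalizing as with
  | nil => cases h; rfl
  | cons w l ih =>
    cases h with
    | cons h1 h2 =>
      rw [List.map_cons, h1.value_eq (hl w (by simp)) hθ hP,
        ih h2 fun w hw => hl w (List.mem_cons_of_mem _ hw)]

theorem represents_map_value {l : List LinkedCode} {P : List RatCode}
    (hl : ∀ w ∈ l, isLinked w P = true) (hiso : ∀ w ∈ l, isIsolating w.1 = true) {θ : ℝ}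
    (hθ : |θ| ≤ 1) (hP : aeval θ (ratPolyRing.val P) = 0) :
    PolyCode.Represents (l.map Prod.fst) (polyOfCoeffs (l.map (LinkedCode.value θ))) := by
  refine ⟨_, ?_, rfl⟩
  rw [List.forall₂_map_left_iff, List.forall₂_map_right_iff, List.forall₂_same]
  intro w hw
  have h := LinkedCode.value_isRoot (hl w hw) hθ hP
  exact isIsolating_unique (hiso w hw) h.1 h.2

/-- Soundness: specialising `T` to a root `θ ∈ [-1, 1]` of the modulus turns a verified witness
into a certificate over the real numbers. -/
theorem Verifies.exists_certificate {codeF : PolyCode} {codeD codeC : AlgCode} {m n : ℕ}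
    {w : Witness} (hw : Verifies (codeF, codeD, codeC, m, n) w) {f : ℝ[X]} {d c : ℝ}
    (hf : PolyCode.Represents codeF f) (hd : AlgCode.Represents codeD d)
    (hc : AlgCode.Represents codeC c) :
    ∃ σ₀ σ₁ : ℝ[X], SosCode.Represents w.result.1 σ₀ ∧ SosCode.Represents w.result.2 σ₁ ∧
      (X - C d) ^ m * (X - C c) ^ (n + 1) = σ₀ + σ₁ * f := by
  obtain ⟨⟨⟨hF, hD, hC⟩, hsign⟩, ⟨hlink, hiso⟩, hzero⟩ := hw
  obtain ⟨θ, hθ, hP⟩ := exists_root_of_changesSign hsign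
  obtain ⟨as, has, rfl⟩ := hf
  have hpoly : w.poly.map (LinkedCode.value θ) = as := by
    refine map_value_eq_of_represents (hF.symm ▸ has) (fun l hl => hlink l ?_) hθ hP
    simp [Witness.links, hl]
  have hleft : w.left.value θ = d :=
    AlgCode.Represents.value_eq (hD.symm ▸ hd) (hlink _ (by simp [Witness.links])) hθ hP
  have hright : w.right.value θ = c :=
    AlgCode.Represents.value_eq (hC.symm ▸ hc) (hlink _ (by simp [Witness.links])) hθ hP
  have hout : ∀ l : List LinkedCode, (∀ a ∈ l, a ∈ w.outputs) →
      PolyCode.Represents (l.map Prod.fst) (polyOfCoeffs (l.map (LinkedCode.value θ))) :=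
    fun l hl => represents_map_value (fun a ha => hlink a (by simp [Witness.links, hl a ha]))
      (fun a ha => hiso _ (List.mem_map_of_mem (hl a ha))) hθ hP
  have hsos : ∀ l₁ l₂ : List LinkedCode, (∀ a ∈ l₁, a ∈ w.outputs) →
      (∀ a ∈ l₂, a ∈ w.outputs) → SosCode.Represents [l₁.map Prod.fst, l₂.map Prod.fst]
        (polyOfCoeffs (l₁.map (LinkedCode.value θ)) ^ 2 +
          polyOfCoeffs (l₂.map (LinkedCode.value θ)) ^ 2) := fun l₁ l₂ h₁ h₂ =>
    ⟨[_, _], .cons (hout l₁ h₁) (.cons (hout l₂ h₂) .nil), by simp⟩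
  refine ⟨_, _, hsos w.sq₁ w.sq₂ ?_ ?_, hsos w.sq₃ w.sq₄ ?_ ?_, ?_⟩
  · intro a ha; simp [Witness.outputs, ha]
  · intro a ha; simp [Witness.outputs, ha]
  · intro a ha; simp [Witness.outputs, ha]
  · intro a ha; simp [Witness.outputs, ha]
  · rw [ratPolyPolyRing.isZero_iff, ratPolyPolyRing.val_sub, sub_eq_zero, val_certLeft,
      val_certRight] at hzero
    have h := congrArg (mapRingHom (aeval θ : ℚ[X] →ₐ[ℚ] ℝ).toRingHom) hzero
    simp only [map_add, map_mul, map_pow, map_sub, map_val_lift, hpoly] at h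
    simp only [coe_mapRingHom, map_X, map_C] at h
    have e1 : (aeval θ : ℚ[X] →ₐ[ℚ] ℝ).toRingHom (ratPolyRing.val w.left.2.1) = d := hleft
    have e2 : (aeval θ : ℚ[X] →ₐ[ℚ] ℝ).toRingHom (ratPolyRing.val w.right.2.1) = c := hright
    have e3 : (aeval θ : ℚ[X] →ₐ[ℚ] ℝ).toRingHom (ratPolyRing.val w.modulus) = 0 := hP
    rw [e1, e2, e3, C_0, zero_mul, add_zero] at h
    exact h

/-! ### Existence of verified witnesses -/

section SmallCharts

open Filter Topology

/-- The affine substitution `T ↦ u + ε T`. -/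
noncomputable def chart (p : ℚ × ℚ) : ℚ[X] := C p.1 + C p.2 * X

/-- The filter of pairs `(u, ε)` that tend to `(θ, 0)` with `|u - θ| < ε`, so that `θ` is in the
image of `[-1, 1]` under the substitution `T ↦ u + ε T`. -/
def smallCharts (θ : ℝ) : Filter (ℚ × ℚ) :=
  comap (fun p : ℚ × ℚ => ((p.1 : ℝ), (p.2 : ℝ))) (𝓝 (θ, 0)) ⊓
    𝓟 {p : ℚ × ℚ | |(p.1 : ℝ) - θ| < p.2}

instance smallCharts_neBot (θ : ℝ) : (smallCharts θ).NeBot := by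
  rw [smallCharts, inf_principal_neBot_iff]
  rintro U ⟨V, hV, hVU⟩
  obtain ⟨δ, hδ, hball⟩ := Metric.mem_nhds_iff.1 hV
  obtain ⟨ε, hε0, hεδ⟩ := exists_rat_btwn hδ
  obtain ⟨u, hu1, hu2⟩ := exists_rat_btwn (show θ - ε < θ by linarith)
  have hu : |(u : ℝ) - θ| < ε := by rw [abs_lt]; constructor <;> linarith
  refine ⟨(u, ε), hVU (hball ?_), hu⟩
  rw [Metric.mem_ball, Prod.dist_eq, Real.dist_eq, Real.dist_eq, sub_zero, abs_of_pos hε0]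
  exact max_lt (hu.trans hεδ) hεδ

theorem smallCharts_eventually_abs_sub_lt (θ : ℝ) : ∀ᶠ p in smallCharts θ, |(p.1 : ℝ) - θ| < p.2 :=
  mem_inf_of_right (mem_principal_self _)

theorem tendsto_smallCharts (θ : ℝ) :
    Tendsto (fun p : ℚ × ℚ => ((p.1 : ℝ), (p.2 : ℝ))) (smallCharts θ) (𝓝 (θ, 0)) :=
  tendsto_comap.mono_left inf_le_left

theorem coeff_comp_chart (b : ℚ[X]) (p : ℚ × ℚ) (i : ℕ) :
    (b.comp (chart p)).coeff i = (hasseDeriv i b).eval p.1 * p.2 ^ i := by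
  have h : b.comp (chart p) = (taylor p.1 b).comp (C p.2 * X) := by
    rw [taylor_apply, comp_assoc, chart]
    simp [add_comm]
  rw [h, comp_C_mul_X_coeff, taylor_coeff]

theorem rat_absSum {A : List RatCode} {N : ℕ} (h : A.length ≤ N) :
    (absSum A).rat = ∑ i ∈ Finset.range N, |(ratPolyRing.val A).coeff i| := by
  induction A generalizing N with
  | nil =>
    have h0 : ratPolyRing.val [] = 0 := rfl
    change ratRing.zero.rat = _
    rw [rat_zero, h0]
    simp
  | cons a A ih =>
    obtain ⟨M, rfl⟩ : ∃ M, N = M + 1 := ⟨N - 1, by simp at h; omega⟩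
    rw [rat_absSum_cons, Finset.sum_range_succ', ratPolyRing_val_cons, add_comm,
      ih (N := M) (by simpa using h)]
    simp [coeff_C]

theorem rat_absSum_tail (A : List RatCode) {D : ℕ}
    (h : ∀ i, D ≤ i → (ratPolyRing.val A).coeff (i + 1) = 0) :
    (absSum A.tail).rat = ∑ i ∈ Finset.range D, |(ratPolyRing.val A).coeff (i + 1)| := by
  have hc : ∀ i, (ratPolyRing.val A.tail).coeff i = (ratPolyRing.val A).coeff (i + 1) := by
    intro i
    rw [ratPolyRing_val_eq_head_add A]
    simp
  rw [rat_absSum (le_max_left A.tail.length D)]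
  simp only [hc]
  refine (Finset.sum_subset (Finset.range_mono (le_max_right _ _)) fun i _ hi => ?_).symm
  rw [h i (by simpa using hi), abs_zero]

theorem rat_head (A : List RatCode) :
    (A.getD 0 ratRing.zero).rat = (ratPolyRing.val A).coeff 0 := by
  rw [ratPolyRing_val_eq_head_add A]
  simp

/-- Under substitutions `T ↦ u + ε T` close to `θ`, the constant coefficient of `b` tends to
`b(θ)` and the other ones tend to `0`. -/
theorem eventually_head_absSum_lt (b : ℚ[X]) (θ : ℝ) {η : ℝ} (hη : 0 < η) :
    ∀ᶠ p in smallCharts θ, ∀ A : List RatCode, ratPolyRing.val A = b.comp (chart p) →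
      |((A.getD 0 ratRing.zero).rat : ℝ) - aeval θ b| + (absSum A.tail).rat < η := by
  let G : ℝ × ℝ → ℝ := fun p => |aeval p.1 b - aeval θ b| +
    ∑ i ∈ Finset.range b.natDegree, |aeval p.1 (hasseDeriv (i + 1) b) * p.2 ^ (i + 1)|
  have hG : Continuous G := by fun_prop
  have h0 : G (θ, 0) = 0 := by simp [G]
  have hlim := (hG.tendsto (θ, 0)).comp (tendsto_smallCharts θ)
  rw [h0] at hlim
  filter_upwards [hlim.eventually_lt_const hη] with p hp A hA
  have hcast : ∀ r : ℚ[X], aeval (p.1 : ℝ) r = ((r.eval p.1 : ℚ) : ℝ) := fun r => by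
    have := aeval_algebraMap_apply_eq_algebraMap_eval (A := ℝ) p.1 r
    rwa [eq_ratCast, eq_ratCast] at this
  refine lt_of_eq_of_lt ?_ hp
  rw [rat_absSum_tail A (D := b.natDegree), rat_head, hA]
  · simp only [coeff_comp_chart, G, Function.comp, hcast]
    push_cast
    simp
  · intro i hi
    rw [hA, coeff_comp_chart, hasseDeriv_eq_zero_of_lt_natDegree _ _ (by omega)]
    simp

theorem eventually_mapsInto {b : ℚ[X]} {θ : ℝ} {I : RatCode × RatCode}
    (h1 : RatCode.val I.1 < aeval θ b) (h2 : aeval θ b < RatCode.val I.2) :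
    ∀ᶠ p in smallCharts θ, ∀ A : List RatCode, ratPolyRing.val A = b.comp (chart p) →
      mapsInto A I = true := by
  rw [RatCode.val_eq] at h1 h2
  filter_upwards [eventually_head_absSum_lt b θ
    (lt_min (sub_pos.2 h1) (sub_pos.2 h2))] with p hp A hA
  obtain ⟨h3, h4⟩ := lt_min_iff.1 (hp A hA)
  obtain ⟨h5, h6⟩ := abs_le.1 (le_refl |((A.getD 0 ratRing.zero).rat : ℝ) - aeval θ b|)
  rw [mapsInto_iff]
  constructor
  · have : (I.1.rat : ℝ) + (absSum A.tail).rat ≤ (A.getD 0 ratRing.zero).rat := by linarith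
    exact_mod_cast this
  · have : ((A.getD 0 ratRing.zero).rat : ℝ) + (absSum A.tail).rat ≤ I.2.rat := by linarith
    exact_mod_cast this

theorem mapsInto_of_val_eq_C {A : List RatCode} {q : ℚ} (hA : ratPolyRing.val A = C q)
    {I : RatCode × RatCode} (h : (q : ℝ) ∈ Set.Icc (RatCode.val I.1) (RatCode.val I.2)) :
    mapsInto A I = true := by
  rw [RatCode.val_eq, RatCode.val_eq] at h
  rw [mapsInto_iff, rat_head, rat_absSum_tail A (D := 0) (by simp [hA]), hA]
  simp only [coeff_C_zero, Finset.range_zero, Finset.sum_empty, add_zero]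
  exact ⟨by exact_mod_cast h.1, by exact_mod_cast h.2⟩

theorem eventually_isPositive {b : ℚ[X]} {θ : ℝ} (h : 0 < aeval θ b) :
    ∀ᶠ p in smallCharts θ, ∀ A : List RatCode, ratPolyRing.val A = b.comp (chart p) →
      isPositive A = true := by
  filter_upwards [eventually_head_absSum_lt b θ h] with p hp A hA
  rw [isPositive_iff]
  have h1 := hp A hA
  obtain ⟨h5, h6⟩ := abs_le.1 (le_refl |((A.getD 0 ratRing.zero).rat : ℝ) - aeval θ b|)
  have : ((absSum A.tail).rat : ℝ) < (A.getD 0 ratRing.zero).rat := by linarith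
  exact_mod_cast this

theorem eventually_changesSign {b : ℚ[X]} {θ : ℝ} (h : aeval θ b = 0)
    (h' : aeval θ (derivative b) ≠ 0) :
    ∀ᶠ p in smallCharts θ, ∀ A : List RatCode, ratPolyRing.val A = b.comp (chart p) →
      changesSign A = true := by
  obtain ⟨g, hg⟩ : X - C θ ∣ b.map (algebraMap ℚ ℝ) := by
    rw [dvd_iff_isRoot, IsRoot.def, eval_map_algebraMap]
    exact h
  have hbx : ∀ x : ℝ, aeval x b = (x - θ) * g.eval x := by
    intro x
    rw [← eval_map_algebraMap, hg]
    simp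
  have hgθ : g.eval θ ≠ 0 := by
    intro h0
    apply h'
    rw [← eval_map_algebraMap, ← derivative_map, hg]
    simp [h0]
  -- The cofactor of the simple root has constant sign near `θ`.
  let G : ℝ × ℝ → ℝ := fun p => g.eval (p.1 - p.2) * g.eval (p.1 + p.2)
  have hG : Continuous G := by fun_prop
  have hG0 : 0 < G (θ, 0) := by
    simp only [G, sub_zero, add_zero]
    exact mul_self_pos.2 hgθ
  have hlim := (hG.tendsto (θ, 0)).comp (tendsto_smallCharts θ)
  filter_upwards [hlim.eventually_const_lt hG0, smallCharts_eventually_abs_sub_lt θ] with p hp hp' A hA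
  rw [abs_lt] at hp'
  have hval : ∀ r : RatCode, (ratRing.horner r A).1.rat = (b.comp (chart p)).eval r.rat := by
    intro r
    rw [← hA]
    exact (ratRing.val_horner r A).1
  rw [changesSign, RatCode.le_iff, rat_mul, rat_zero, hval, hval, rat_negOne, rat_one]
  have hcast : ∀ t : ℚ, ((eval t (b.comp (chart p)) : ℚ) : ℝ) = aeval ((p.1 + p.2 * t : ℚ) : ℝ) b := by
    intro t
    have := aeval_algebraMap_apply_eq_algebraMap_eval (A := ℝ) (p.1 + p.2 * t) b
    rw [eq_ratCast, eq_ratCast] at this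
    rw [this, eval_comp, chart]
    simp
  have key : ((eval (-1) (b.comp (chart p)) * eval 1 (b.comp (chart p)) : ℚ) : ℝ) ≤ 0 := by
    push_cast
    rw [hcast, hcast, hbx, hbx]
    push_cast
    have e1 : (p.1 : ℝ) + p.2 * -1 = p.1 - p.2 := by ring
    have e2 : (p.1 : ℝ) + p.2 * 1 = p.1 + p.2 := by ring
    rw [e1, e2]
    have h1 : 0 < g.eval ((p.1 : ℝ) - p.2) * g.eval ((p.1 : ℝ) + p.2) := hp
    have h2 : ((p.1 : ℝ) - p.2 - θ) * (p.1 + p.2 - θ) ≤ 0 :=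
      mul_nonpos_of_nonpos_of_nonneg (by linarith) (by linarith)
    have := mul_nonpos_of_nonpos_of_nonneg h2 h1.le
    linarith
  exact_mod_cast key

end SmallCharts

/-- The number `x` is a root of the polynomial of the code `a` and lies in its interval, in the
interior unless `x` is rational. That `a` isolates `x` is not part of the definition. -/
def IsGenericCode (a : AlgCode) (x : ℝ) : Prop :=
  x ∈ Set.Icc (RatCode.val a.2.1) (RatCode.val a.2.2) ∧ aeval x (polyOfCoeffs a.1) = 0 ∧
    ((∀ q : ℚ, x ≠ q) → RatCode.val a.2.1 < x ∧ x < RatCode.val a.2.2)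

theorem AlgCode.Represents.isGenericCode {a : AlgCode} {x : ℝ} (h : AlgCode.Represents a x) :
    IsGenericCode a x := by
  refine ⟨h.2.1, h.2.2.1, fun hq => ⟨h.2.1.1.lt_of_ne ?_, h.2.1.2.lt_of_ne ?_⟩⟩
  · rw [RatCode.val_eq]; exact (hq _).symm
  · rw [RatCode.val_eq]; exact hq _

theorem AlgCode.Represents.isAlgebraic {a : AlgCode} {x : ℝ} (h : AlgCode.Represents a x) :
    IsAlgebraic ℚ x :=
  (IsFractionRing.isAlgebraic_iff ℤ ℚ ℝ).1 ⟨_, h.1, h.2.2.1⟩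

theorem exists_int_poly_simple_root {x : ℝ} (hx : IsAlgebraic ℚ x) :
    ∃ q : ℤ[X], aeval x q = 0 ∧ 0 < aeval x (derivative q) := by
  obtain ⟨k, hk, h⟩ := IsLocalization.integerNormalization_spec (nonZeroDivisors ℤ)
    (minpoly ℚ x)
  set q := IsLocalization.integerNormalization (nonZeroDivisors ℤ) (minpoly ℚ x)
  have hk0 : k ≠ 0 := nonZeroDivisors.ne_zero hk
  have hq : q.map (algebraMap ℤ ℚ) = C (k : ℚ) * minpoly ℚ x := by
    rw [h, zsmul_eq_mul]; simp
  have h0 : aeval x q = 0 := by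
    rw [← aeval_map_algebraMap ℚ, hq, map_mul, minpoly.aeval, mul_zero]
  have h1 : aeval x (derivative q) ≠ 0 := by
    rw [← aeval_map_algebraMap ℚ, ← derivative_map, hq, derivative_C_mul, map_mul, aeval_C]
    refine mul_ne_zero (by simpa using hk0) ?_
    exact (minpoly.irreducible hx.isIntegral).separable.aeval_derivative_ne_zero
      (minpoly.aeval ℚ x)
  rcases lt_or_gt_of_ne h1 with h2 | h2
  · exact ⟨-q, by simp [h0], by simpa using h2⟩
  · exact ⟨q, h0, h2⟩

theorem exists_isIsolating_code {x : ℝ} (hx : IsAlgebraic ℚ x) :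
    ∃ a : AlgCode, isIsolating a = true ∧ IsGenericCode a x := by
  obtain ⟨q, hq0, hq1⟩ := exists_int_poly_simple_root hx
  have h1 : 0 < aeval x ((derivative q).map (algebraMap ℤ ℚ)) := by
    rwa [aeval_map_algebraMap]
  obtain ⟨p, hp1, hp2⟩ := ((eventually_isPositive h1).and (smallCharts_eventually_abs_sub_lt x)).exists
  obtain ⟨lo, hlo⟩ := RatCode.surjective_rat (p.1 - p.2)
  obtain ⟨hi, hhi⟩ := RatCode.surjective_rat (p.1 + p.2)
  rw [abs_lt] at hp2
  have h2 : RatCode.val lo < x := by rw [RatCode.val_eq, hlo]; push_cast; linarith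
  have h3 : x < RatCode.val hi := by rw [RatCode.val_eq, hhi]; push_cast; linarith
  refine ⟨(ascCoeffs q, lo, hi), hp1 _ ?_, ⟨h2.le, h3.le⟩, ?_, fun _ => ⟨h2, h3⟩⟩
  · rw [(val_horner_constCoeffs _ _).2, val_intervalChart, polyOfCoeffs_ascCoeffs]
    have e : C ((lo.rat + hi.rat) / 2) + C ((hi.rat - lo.rat) / 2) * X = chart p := by
      rw [hlo, hhi, chart]
      congr 3 <;> ring_nf
    change aeval (C ((lo.rat + hi.rat) / 2) + C ((hi.rat - lo.rat) / 2) * X) (derivative q) = _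
    rw [e, comp, eval₂_map, aeval_def]
    congr 1
  · rw [polyOfCoeffs_ascCoeffs]; exact hq0

theorem exists_primitive_real (L : List ℝ) (hL : ∀ x ∈ L, IsAlgebraic ℚ x) :
    ∃ θ : ℝ, IsAlgebraic ℚ θ ∧ ∀ x ∈ L, ∃ b : ℚ[X], aeval θ b = x := by
  have hfin : Finite {x | x ∈ L} := L.finite_toSet
  have := IntermediateField.finiteDimensional_adjoin (K := ℚ) (S := {x | x ∈ L})
    fun x hx => (hL x hx).isIntegral
  obtain ⟨α, hα⟩ := Field.exists_primitive_element ℚ (IntermediateField.adjoin ℚ {x | x ∈ L})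
  have halg : IsAlgebraic ℚ α := Algebra.IsAlgebraic.isAlgebraic α
  refine ⟨α, halg.algebraMap, fun x hx => ?_⟩
  have hmem : (⟨x, IntermediateField.subset_adjoin _ _ hx⟩ :
      IntermediateField.adjoin ℚ {x | x ∈ L}) ∈ (IntermediateField.adjoin ℚ {α}).toSubalgebra := by
    rw [hα]; trivial
  rw [IntermediateField.adjoin_simple_toSubalgebra_of_isAlgebraic halg,
    Algebra.adjoin_singleton_eq_range_aeval] at hmem
  obtain ⟨b, hb⟩ := hmem
  refine ⟨b, ?_⟩
  have h := congrArg (algebraMap (IntermediateField.adjoin ℚ {x | x ∈ L}) ℝ) hb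
  exact (aeval_algebraMap_apply _ α b).trans h

/-- A code of a polynomial with rational coefficients. -/
noncomputable def ratPolyCode : ℚ[X] → List RatCode := Function.surjInv ratPolyRing.surjective

theorem val_ratPolyCode (b : ℚ[X]) : ratPolyRing.val (ratPolyCode b) = b :=
  Function.surjInv_eq _ _

theorem C_minpoly_dvd {θ : ℝ} {p : ℚ[X][X]}
    (h : mapRingHom (aeval θ : ℚ[X] →ₐ[ℚ] ℝ).toRingHom p = 0) : C (minpoly ℚ θ) ∣ p := by
  rw [C_dvd_iff_dvd_coeff]
  intro i
  refine minpoly.dvd ℚ θ ?_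
  have := congrArg (coeff · i) h
  simpa using this

/-- The linked code of a coded number `e`, in the chart `p`, from a polynomial `β e.2` for
the number and the quotient `κ e`. -/
noncomputable def mkLink (p : ℚ × ℚ) (β : ℝ → ℚ[X]) (κ : AlgCode × ℝ → ℚ[X])
    (e : AlgCode × ℝ) : LinkedCode :=
  (e.1, ratPolyCode ((β e.2).comp (chart p)), ratPolyCode ((κ e).comp (chart p)))

theorem isLinked_mkLink {p : ℚ × ℚ} {β : ℝ → ℚ[X]} {κ : AlgCode × ℝ → ℚ[X]} {e : AlgCode × ℝ}
    {P : ℚ[X]} (h : aeval (β e.2) (polyOfCoeffs e.1.1) = P * κ e)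
    (hI : mapsInto (ratPolyCode ((β e.2).comp (chart p))) e.1.2 = true) :
    isLinked (mkLink p β κ e) (ratPolyCode (P.comp (chart p))) = true := by
  rw [isLinked_iff]
  refine ⟨?_, hI⟩
  simp only [mkLink, val_ratPolyCode]
  have h1 := congrArg (compRingHom (chart p)) h
  rw [map_mul, coe_compRingHom_apply, coe_compRingHom_apply, coe_compRingHom_apply] at h1
  rw [← h1]
  exact (aeval_algHom_apply (compRingHom (chart p)).toIntAlgHom (β e.2) (polyOfCoeffs e.1.1))

theorem val_lift_mkLink (p : ℚ × ℚ) (β : ℝ → ℚ[X]) (κ : AlgCode × ℝ → ℚ[X])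
    (l : List (AlgCode × ℝ)) : ratPolyPolyRing.val (lift (l.map (mkLink p β κ))) =
      mapRingHom (compRingHom (chart p)) (polyOfCoeffs (l.map fun e => β e.2)) := by
  rw [ratPolyPolyRing_val, coe_mapRingHom, ← polyOfCoeffs_map, lift, List.map_map, List.map_map,
    List.map_map]
  congr 2
  funext e
  simp [mkLink, val_ratPolyCode]

theorem map_polyOfCoeffs_of_aeval {θ : ℝ} {β : ℝ → ℚ[X]} {l : List (AlgCode × ℝ)}
    (h : ∀ e ∈ l, aeval θ (β e.2) = e.2) :
    mapRingHom (aeval θ : ℚ[X] →ₐ[ℚ] ℝ).toRingHom (polyOfCoeffs (l.map fun e => β e.2)) =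
      polyOfCoeffs (l.map Prod.snd) := by
  rw [coe_mapRingHom, ← polyOfCoeffs_map, List.map_map]
  congr 1
  exact List.map_congr_left fun e he => h e he

/-- Polynomials in `θ` for finitely many numbers. A rational number gets the constant polynomial,
as it may be an end point of the closed interval of its code. -/
theorem exists_lift_family {θ : ℝ} {L : List ℝ} (h : ∀ x ∈ L, ∃ b : ℚ[X], aeval θ b = x) :
    ∃ β : ℝ → ℚ[X], ∀ x ∈ L, aeval θ (β x) = x ∧ ∀ q : ℚ, x = q → β x = C q := by
  have h' : ∀ x : ℝ, ∃ b : ℚ[X], x ∈ L → aeval θ b = x ∧ ∀ q : ℚ, x = q → b = C q := by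
    intro x
    by_cases hq : ∃ q : ℚ, x = q
    · obtain ⟨q, rfl⟩ := hq
      exact ⟨C q, fun _ => ⟨by simp, fun r hr => by rw [Rat.cast_injective hr]⟩⟩
    · by_cases hx : x ∈ L
      · obtain ⟨b, hb⟩ := h x hx
        exact ⟨b, fun _ => ⟨hb, fun q hxq => absurd ⟨q, hxq⟩ hq⟩⟩
      · exact ⟨0, fun h => absurd h hx⟩
  choose β hβ using h'
  exact ⟨β, hβ⟩

theorem exists_quotient_family {θ : ℝ} {β : ℝ → ℚ[X]} {l : List (AlgCode × ℝ)}
    (h : ∀ e ∈ l, aeval θ (β e.2) = e.2 ∧ aeval e.2 (polyOfCoeffs e.1.1) = 0) :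
    ∃ κ : AlgCode × ℝ → ℚ[X], ∀ e ∈ l,
      aeval (β e.2) (polyOfCoeffs e.1.1) = minpoly ℚ θ * κ e := by
  have h' : ∀ e : AlgCode × ℝ, ∃ g : ℚ[X], e ∈ l →
      aeval (β e.2) (polyOfCoeffs e.1.1) = minpoly ℚ θ * g := by
    intro e
    by_cases he : e ∈ l
    · obtain ⟨g, hg⟩ : minpoly ℚ θ ∣ aeval (β e.2) (polyOfCoeffs e.1.1) := by
        refine minpoly.dvd ℚ θ ?_
        rw [← aeval_aeval_int, (h e he).1, (h e he).2]
      exact ⟨g, fun _ => hg⟩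
    · exact ⟨0, fun h => absurd h he⟩
  choose κ hκ using h'
  exact ⟨κ, hκ⟩

/-- Near `θ`, the substituted polynomial of a number maps `[-1, 1]` into the interval of a
generic code. A rational number may be an end point, and then its polynomial is constant. -/
theorem IsGenericCode.eventually_mapsInto {a : AlgCode} {x θ : ℝ} (h : IsGenericCode a x)
    {b : ℚ[X]} (hb : aeval θ b = x) (hb' : ∀ q : ℚ, x = q → b = C q) :
    ∀ᶠ p in smallCharts θ, mapsInto (ratPolyCode (b.comp (chart p))) a.2 = true := by
  by_cases hq : ∃ q : ℚ, x = q
  · obtain ⟨q, hxq⟩ := hq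
    refine Filter.Eventually.of_forall fun p => ?_
    rw [hb' q hxq, C_comp]
    exact mapsInto_of_val_eq_C (val_ratPolyCode _) (hxq ▸ h.1)
  · push Not at hq
    obtain ⟨h1, h2⟩ := h.2.2 hq
    filter_upwards [_root_.eventually_mapsInto (b := b) (θ := θ) (I := a.2)
      (by rwa [hb]) (by rwa [hb])] with p hp
    exact hp _ (val_ratPolyCode _)

theorem exists_coded_list_of_represents {l : PolyCode} {as : List ℝ}
    (h : List.Forall₂ AlgCode.Represents l as) : ∃ es : List (AlgCode × ℝ),
      es.map Prod.fst = l ∧ es.map Prod.snd = as ∧ ∀ e ∈ es, AlgCode.Represents e.1 e.2 := by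
  induction h with
  | nil => exact ⟨[], by simp⟩
  | @cons a x l as h _ ih =>
    obtain ⟨es, h1, h2, h3⟩ := ih
    exact ⟨(a, x) :: es, by simp [h1], by simp [h2], by simpa [h] using h3⟩

theorem exists_coded_list {as : List ℝ} (h : ∀ x ∈ as, IsAlgebraic ℚ x) :
    ∃ es : List (AlgCode × ℝ), es.map Prod.snd = as ∧
      ∀ e ∈ es, isIsolating e.1 = true ∧ IsGenericCode e.1 e.2 ∧ IsAlgebraic ℚ e.2 := by
  induction as with
  | nil => exact ⟨[], by simp⟩
  | cons x as ih =>
    obtain ⟨es, h1, h2⟩ := ih fun y hy => h y (List.mem_cons_of_mem _ hy)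
    obtain ⟨a, ha⟩ := exists_isIsolating_code (h x (by simp))
    refine ⟨(a, x) :: es, by simp [h1], fun e he => ?_⟩
    rcases List.mem_cons.1 he with rfl | he
    · exact ⟨ha.1, ha.2, h x (by simp)⟩
    · exact h2 e he

theorem exists_coded_poly {p : ℝ[X]} (h : ∀ i, IsAlgebraic ℚ (p.coeff i)) :
    ∃ es : List (AlgCode × ℝ), polyOfCoeffs (es.map Prod.snd) = p ∧
      ∀ e ∈ es, isIsolating e.1 = true ∧ IsGenericCode e.1 e.2 ∧ IsAlgebraic ℚ e.2 := by
  obtain ⟨es, h1, h2⟩ := exists_coded_list (as := ascCoeffs p) (by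
    intro x hx
    obtain ⟨i, -, rfl⟩ := List.mem_map.1 hx
    exact h i)
  exact ⟨es, by rw [h1, polyOfCoeffs_ascCoeffs], h2⟩

/-- Completeness: every certificate with algebraic coefficients is found by a verified witness. The
modulus is the minimal polynomial of a primitive element `θ` of the field generated by all the
coefficients, after a substitution `T ↦ u + ε T` that magnifies a small neighbourhood of `θ`. -/
theorem exists_verifies {codeF : PolyCode} {codeD codeC : AlgCode} {m n : ℕ} {f : ℝ[X]} {d c : ℝ}
    (hf : PolyCode.Represents codeF f) (hd : AlgCode.Represents codeD d)
    (hc : AlgCode.Represents codeC c) {p q r s : ℝ[X]}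
    (hp : ∀ i, IsAlgebraic ℚ (p.coeff i)) (hq : ∀ i, IsAlgebraic ℚ (q.coeff i))
    (hr : ∀ i, IsAlgebraic ℚ (r.coeff i)) (hs : ∀ i, IsAlgebraic ℚ (s.coeff i))
    (hcert : (X - C d) ^ m * (X - C c) ^ (n + 1) = (p ^ 2 + q ^ 2) + (r ^ 2 + s ^ 2) * f) :
    ∃ w, Verifies (codeF, codeD, codeC, m, n) w := by
  obtain ⟨as, has, rfl⟩ := hf
  obtain ⟨lf, hlf1, rfl, hlf⟩ := exists_coded_list_of_represents has
  obtain ⟨lp, rfl, hlp⟩ := exists_coded_poly hp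
  obtain ⟨lq, rfl, hlq⟩ := exists_coded_poly hq
  obtain ⟨lr, rfl, hlr⟩ := exists_coded_poly hr
  obtain ⟨ls, rfl, hls⟩ := exists_coded_poly hs
  set outs := lp ++ lq ++ (lr ++ ls) with houts
  set all := (codeD, d) :: (codeC, c) :: (lf ++ outs) with hall
  have hout : ∀ e ∈ outs, isIsolating e.1 = true ∧ IsGenericCode e.1 e.2 ∧
      IsAlgebraic ℚ e.2 := by
    intro e he
    simp only [houts, List.mem_append] at he
    rcases he with (he | he) | (he | he)
    exacts [hlp e he, hlq e he, hlr e he, hls e he]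
  have hgen : ∀ e ∈ all, IsGenericCode e.1 e.2 ∧ IsAlgebraic ℚ e.2 := by
    intro e he
    simp only [hall, List.mem_cons, List.mem_append] at he
    rcases he with rfl | rfl | he | he
    exacts [⟨hd.isGenericCode, hd.isAlgebraic⟩, ⟨hc.isGenericCode, hc.isAlgebraic⟩,
      ⟨(hlf e he).isGenericCode, (hlf e he).isAlgebraic⟩, (hout e he).2]
  obtain ⟨θ, hθ, hgenθ⟩ := exists_primitive_real (all.map Prod.snd) (by
    intro x hx
    obtain ⟨e, he, rfl⟩ := List.mem_map.1 hx
    exact (hgen e he).2)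
  obtain ⟨β, hβ⟩ := exists_lift_family hgenθ
  have hβ' : ∀ e ∈ all, aeval θ (β e.2) = e.2 ∧ ∀ t : ℚ, e.2 = t → β e.2 = C t :=
    fun e he => hβ _ (List.mem_map_of_mem he)
  obtain ⟨κ, hκ⟩ := exists_quotient_family (l := all)
    fun e he => ⟨(hβ' e he).1, (hgen e he).1.2.1⟩
  have hmaps : ∀ᶠ z in smallCharts θ, ∀ e ∈ all,
      mapsInto (ratPolyCode ((β e.2).comp (chart z))) e.1.2 = true :=
    (Filter.eventually_all_finite all.finite_toSet).2 fun e he =>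
      (hgen e he).1.eventually_mapsInto (hβ' e he).1 (hβ' e he).2
  obtain ⟨z, hz1, hz2⟩ := (hmaps.and (eventually_changesSign (minpoly.aeval ℚ θ)
    ((minpoly.irreducible hθ.isIntegral).separable.aeval_derivative_ne_zero
      (minpoly.aeval ℚ θ)))).exists
  let Ψ : List (AlgCode × ℝ) → ℚ[X][X] := fun l => polyOfCoeffs (l.map fun e => β e.2)
  have hΨ : ∀ l : List (AlgCode × ℝ), (∀ e ∈ l, e ∈ all) →
      mapRingHom (aeval θ : ℚ[X] →ₐ[ℚ] ℝ).toRingHom (Ψ l) = polyOfCoeffs (l.map Prod.snd) :=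
    fun l hl => map_polyOfCoeffs_of_aeval fun e he => (hβ' e (hl e he)).1
  obtain ⟨H, hH⟩ : C (minpoly ℚ θ) ∣ (X - C (β d)) ^ m * (X - C (β c)) ^ (n + 1) -
      ((Ψ lp ^ 2 + Ψ lq ^ 2) + (Ψ lr ^ 2 + Ψ ls ^ 2) * Ψ lf) := by
    refine C_minpoly_dvd ?_
    have e1 : (aeval θ : ℚ[X] →ₐ[ℚ] ℝ).toRingHom (β d) = d :=
      (hβ' (codeD, d) (by simp [hall])).1
    have e2 : (aeval θ : ℚ[X] →ₐ[ℚ] ℝ).toRingHom (β c) = c :=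
      (hβ' (codeC, c) (by simp [hall])).1
    simp only [map_sub, map_add, map_mul, map_pow]
    rw [hΨ lp (fun e he => by simp [hall, houts, he]), hΨ lq (fun e he => by simp [hall, houts, he]),
      hΨ lr (fun e he => by simp [hall, houts, he]), hΨ ls (fun e he => by simp [hall, houts, he]),
      hΨ lf (fun e he => by simp [hall, he])]
    simp only [coe_mapRingHom, map_X, map_C, e1, e2]
    rw [hcert, sub_self]
  obtain ⟨h, hh⟩ := ratPolyPolyRing.surjective (mapRingHom (compRingHom (chart z)) H)
  let k := mkLink z β κ
  let w : Witness := (ratPolyCode ((minpoly ℚ θ).comp (chart z)), (k (codeD, d), k (codeC, c)),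
    lf.map k, ((lp.map k, lq.map k), (lr.map k, ls.map k)), h)
  have hwout : w.outputs = outs.map k := by
    simp [Witness.outputs, Witness.sq₁, Witness.sq₂, Witness.sq₃, Witness.sq₄, w, houts]
  have hwlinks : w.links = all.map k := by
    simp [Witness.links, hwout, hall, Witness.left, Witness.right, Witness.poly, w]
  refine ⟨w, ⟨⟨?_, rfl, rfl⟩, hz2 _ (val_ratPolyCode _)⟩, ⟨?_, ?_⟩, ?_⟩
  · rw [← hlf1]
    change (lf.map k).map Prod.fst = _
    rw [List.map_map]; rfl
  · rw [hwlinks]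
    intro l hl
    obtain ⟨e, he, rfl⟩ := List.mem_map.1 hl
    exact isLinked_mkLink (hκ e he) (hz1 e he)
  · rw [hwout, List.map_map]
    intro a ha
    obtain ⟨e, he, rfl⟩ := List.mem_map.1 ha
    exact (hout e he).1
  · rw [ratPolyPolyRing.isZero_iff, ratPolyPolyRing.val_sub, val_certLeft, val_certRight]
    have h1 := congrArg (mapRingHom (compRingHom (chart z))) hH
    simp only [map_sub, map_add, map_mul, map_pow] at h1
    rw [← hh] at h1
    simp only [Ψ, ← val_lift_mkLink z β κ] at h1
    simp only [coe_mapRingHom, map_X, map_C, coe_compRingHom_apply] at h1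
    have e1 : ratPolyRing.val w.left.2.1 = (β d).comp (chart z) := val_ratPolyCode _
    have e2 : ratPolyRing.val w.right.2.1 = (β c).comp (chart z) := val_ratPolyCode _
    have e3 : ratPolyRing.val w.modulus = (minpoly ℚ θ).comp (chart z) := val_ratPolyCode _
    rw [e1, e2, e3, ← add_assoc, ← sub_sub, sub_eq_zero]
    exact h1

/-! ### Gap data of compact semialgebraic subsets of the line -/

section GapDatum

theorem IsIntervalUnion.strictMono {S : Set ℝ} {k : ℕ} {c d : Fin (k + 1) → ℝ}
    (h : IsIntervalUnion S c d) : StrictMono c ∧ StrictMono d := by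
  constructor <;> rw [Fin.strictMono_iff_lt_succ] <;> intro i
  · exact (h.le _).trans_lt (h.lt i)
  · exact (h.lt i).trans_le (h.le _)

theorem mem_semialgebraicSet_singleton {f : ℝ[X]} {x : ℝ} :
    x ∈ semialgebraicSet {f} ↔ 0 ≤ f.eval x := by
  simp [semialgebraicSet]

variable {f : ℝ[X]} {k : ℕ} {c d : Fin (k + 1) → ℝ} {j : Fin k} {m n : ℕ}

theorem IsGapDatum.eval_neg_of_mem_gap (h : IsGapDatum f c d j m n) {x : ℝ}
    (hx : x ∈ Set.Ioo (d j.castSucc) (c j.succ)) : f.eval x < 0 := by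
  by_contra! h0
  have hmem := mem_semialgebraicSet_singleton.2 h0
  rw [h.intervals.eq_iUnion, Set.mem_iUnion] at hmem
  obtain ⟨i, hi⟩ := hmem
  rcases le_or_gt i j.castSucc with hij | hij
  · exact absurd (hi.2.trans (h.intervals.strictMono.2.monotone hij)) (not_le.2 hx.1)
  · have hij' : j.succ ≤ i := Fin.castSucc_lt_iff_succ_le.1 hij
    exact absurd ((h.intervals.strictMono.1.monotone hij').trans hi.1) (not_le.2 hx.2)

theorem IsGapDatum.eval_neg_of_lt_abs (h : IsGapDatum f c d j m n) {x : ℝ}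
    (hx : max |c 0| |d (Fin.last k)| < |x|) : f.eval x < 0 := by
  by_contra! h0
  have hmem := mem_semialgebraicSet_singleton.2 h0
  rw [h.intervals.eq_iUnion, Set.mem_iUnion] at hmem
  obtain ⟨i, hi⟩ := hmem
  have h1 := (h.intervals.strictMono.1.monotone (Fin.zero_le i)).trans hi.1
  have h2 := hi.2.trans (h.intervals.strictMono.2.monotone (Fin.le_last i))
  exact absurd (abs_le_max_abs_abs h1 h2) (not_le.2 hx)

theorem IsGapDatum.exists_certificate {K : Type*} [Field K] [Algebra K ℝ]
    (hK : AlgClosedInReal K) {f : K[X]} {d' c' : K}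
    (h : IsGapDatum (f.map (algebraMap K ℝ)) c d j m n) (hd : algebraMap K ℝ d' = d j.castSucc)
    (hc : algebraMap K ℝ c' = c j.succ) :
    ∃ p q r s : K[X], (X - C d') ^ m * (X - C c') ^ (n + 1) =
      (p ^ 2 + q ^ 2) + (r ^ 2 + s ^ 2) * f := by
  have h1 := h.dvd
  have h2 := h.left_exact
  have h3 := h.right_exact
  have hX : ∀ a : K, (X - C (algebraMap K ℝ a) : ℝ[X]) = (X - C a).map (algebraMap K ℝ) := by
    simp
  rw [← hd, ← hc, hX, hX, ← Polynomial.map_pow, ← Polynomial.map_pow, ← Polynomial.map_mul,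
    map_dvd_map'] at h1
  rw [← hd, hX, ← Polynomial.map_pow, map_dvd_map'] at h2
  rw [← hc, hX, ← Polynomial.map_pow, map_dvd_map'] at h3
  refine hK.exists_gap_certificate ?_ h.odd h.even h1 h2 h3 (fun x hx => ?_)
    (R := max |c 0| |d (Fin.last k)|) (fun x hx => ?_)
  · rw [hd, hc]; exact h.intervals.lt j
  · rw [← eval_map_algebraMap]
    exact h.eval_neg_of_mem_gap (by rwa [hd, hc] at hx)
  · rw [← eval_map_algebraMap]
    exact h.eval_neg_of_lt_abs hx

theorem algClosedInReal_real : AlgClosedInReal ℝ := fun x _ => ⟨x, rfl⟩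

theorem algClosedInReal_algebraicClosure : AlgClosedInReal (algebraicClosure ℚ ℝ) := by
  intro x hx
  have : Algebra.IsAlgebraic ℚ (algebraicClosure ℚ ℝ) := ⟨fun y =>
    (isAlgebraic_algebraMap_iff (algebraMap (algebraicClosure ℚ ℝ) ℝ).injective).1
      (mem_algebraicClosure_iff.1 y.2)⟩
  exact ⟨⟨x, mem_algebraicClosure_iff.2 (hx.restrictScalars ℚ)⟩, rfl⟩

theorem exists_map_eq_of_represents {l : PolyCode} {f : ℝ[X]} (h : PolyCode.Represents l f) :
    ∃ g : (algebraicClosure ℚ ℝ)[X], g.map (algebraMap (algebraicClosure ℚ ℝ) ℝ) = f := by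
  obtain ⟨as, has, rfl⟩ := h
  obtain ⟨es, -, rfl, hes⟩ := exists_coded_list_of_represents has
  refine (mem_lifts _).1 ((lifts_iff_coeff_lifts _).2 fun i => ?_)
  have halg : IsAlgebraic ℚ ((polyOfCoeffs (es.map Prod.snd)).coeff i) := by
    rw [coeff_polyOfCoeffs]
    by_cases hi : i < (es.map Prod.snd).length
    · rw [List.getD_eq_getElem _ _ hi]
      obtain ⟨e, he, h⟩ := List.mem_map.1 (List.getElem_mem hi)
      rw [← h]
      exact (hes e he).isAlgebraic
    · rw [List.getD_eq_default _ _ (not_lt.1 hi)]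
      exact isAlgebraic_zero
  exact ⟨⟨_, mem_algebraicClosure_iff.2 halg⟩, rfl⟩

theorem isAlgebraic_coeff_map (g : (algebraicClosure ℚ ℝ)[X]) (i : ℕ) :
    IsAlgebraic ℚ ((g.map (algebraMap (algebraicClosure ℚ ℝ) ℝ)).coeff i) := by
  rw [coeff_map]
  exact mem_algebraicClosure_iff.1 (g.coeff i).2

end GapDatum

theorem mainTheorem6 :
    (∀ (f : ℝ[X]) (k : ℕ) (c d : Fin (k + 1) → ℝ) (j : Fin k) (m n : ℕ),
      IsGapDatum f c d j m n →
        (X - C (d j.castSucc)) ^ m * (X - C (c j.succ)) ^ (n + 1) ∈ quadraticModule {f}) ∧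
    (∃ F : PolyCode × AlgCode × AlgCode × ℕ × ℕ →. SosCode × SosCode,
      Partrec F ∧
      ∀ (f : ℝ[X]) (k : ℕ) (c d : Fin (k + 1) → ℝ) (j : Fin k) (m n : ℕ),
        IsGapDatum f c d j m n →
        ∀ (codeF : PolyCode) (codeD codeC : AlgCode),
          PolyCode.Represents codeF f →
          AlgCode.Represents codeD (d j.castSucc) →
          AlgCode.Represents codeC (c j.succ) →
          ∃ out ∈ F (codeF, codeD, codeC, m, n), ∃ σ₀ σ₁ : ℝ[X],
            SosCode.Represents out.1 σ₀ ∧ SosCode.Represents out.2 σ₁ ∧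
            (X - C (d j.castSucc)) ^ m * (X - C (c j.succ)) ^ (n + 1) = σ₀ + σ₁ * f) := by
  refine ⟨fun f k c d j m n h => ?_, searchCertificate, partrec_searchCertificate,
    fun f k c d j m n h codeF codeD codeC hf hd hc => ?_⟩
  · obtain ⟨p, q, r, s, hcert⟩ := IsGapDatum.exists_certificate algClosedInReal_real (f := f)
      (d' := d j.castSucc) (c' := c j.succ) (by simpa using h) rfl rfl
    have hsq : ∀ a b : ℝ[X], IsSumSq (a ^ 2 + b ^ 2) := fun a b =>
      (IsSquare.isSumSq ⟨a, sq a⟩).add (IsSquare.isSumSq ⟨b, sq b⟩)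
    exact ⟨p ^ 2 + q ^ 2, fun _ => r ^ 2 + s ^ 2, hsq p q, fun _ _ => hsq r s, by
      rw [hcert, Finset.sum_singleton]⟩
  · obtain ⟨g, rfl⟩ := exists_map_eq_of_represents hf
    obtain ⟨p, q, r, s, hcert⟩ := IsGapDatum.exists_certificate algClosedInReal_algebraicClosure
      h (d' := ⟨_, mem_algebraicClosure_iff.2 hd.isAlgebraic⟩)
      (c' := ⟨_, mem_algebraicClosure_iff.2 hc.isAlgebraic⟩) rfl rfl
    have hcert' := congrArg (Polynomial.map (algebraMap (algebraicClosure ℚ ℝ) ℝ)) hcert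
    simp only [Polynomial.map_mul, Polynomial.map_pow, Polynomial.map_add, Polynomial.map_sub,
      map_X, map_C] at hcert'
    obtain ⟨w, hw⟩ := exists_verifies hf hd hc (isAlgebraic_coeff_map p) (isAlgebraic_coeff_map q)
      (isAlgebraic_coeff_map r) (isAlgebraic_coeff_map s) hcert'
    obtain ⟨w', hw', hout⟩ := searchCertificate_spec hw
    exact ⟨w'.result, hout, hw'.exists_certificate hf hd hc⟩
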